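/- Let $G=\mathrm{GL}_3(\mathbb{R})$ and $H=\mathrm{GL}_2(\mathbb{R})$, with $H$ embedded in $G$ by $h\mapsto \operatorname{diag}(h,1)$, and let $P_G$, $P_H$ be the subgroups of invertible upper triangular matrices. For $\xi\in(\mathbb{Z}/2\mathbb{Z})^n$ and $\lambda\in\mathbb{C}^n$, the principal series representation of $\mathrm{GL}_n(\mathbb{R})$ with parameters $(\xi,\lambda)$ is the left-regular representation on the space of all $f\in C^\infty(\mathrm{GL}_n(\mathbb{R}))$ such that $$f(gp)=\prod_{i=1}^n \operatorname{sgn}(p_{ii})^{\xi_i}\,|p_{ii}|^{-\lambda_i-\rho_i}\,f(g)\qquad\text{for all invertible upper triangular } p,\qquad \rho_i=\tfrac{n+1}{2}-i.$$ Let $\pi_{\xi,\lambda}$ be this representation for $G$, with $\xi\in(\mathbb{Z}/2\mathbb{Z})^3$, $\lambda\in\mathbb{C}^3$, and $\tau_{\eta,\nu}$ this representation for $H$, with $\eta\in(\mathbb{Z}/2\mathbb{Z})^2$, $\nu\in\mathbb{C}^2$. Their elements are regarded as sections of line bundles over $G/P_G$ and $H/P_H$. Let $$x_0=\begin{pmatrix}0&1&0\\0&0&1\\1&0&0\end{pmatrix},\qquad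 p_0:H/P_H\to G/P_G,\quad hP_H\mapsto hx_0P_G,$$ and let $\mathrm{DSBO}_0(\pi_{\xi,\lambda},\tau_{\eta,\nu})$ be the vector space of all linear $H$-intertwining maps $T:\pi_{\xi,\lambda}\to\tau_{\eta,\nu}$ such that $p_0(\operatorname{supp}Tf)\subseteq\operatorname{supp}f$ for all $f\in\pi_{\xi,\lambda}$, where the supports are those of sections over $H/P_H$ and $G/P_G$. Put $$n_1=\lambda_3-\nu_2-\tfrac12,\qquad n_2=\lambda_2+\lambda_3-\nu_1-\nu_2-1 .$$ 1. Suppose that $n_1,n_2\in\mathbb{N}=\{0,1,2,\dots\}$, that $n_1\le n_2$ or there is an integer $0\le k_0\le n_2$ with $\lambda_3-\lambda_2-n_1+k_0=0$, and that, modulo $2$, $$\eta_1=\xi_2+n_1+n_2,\qquad \eta_2=\xi_3+n_1 .$$ Then $\dim\mathrm{DSBO}_0(\pi_{\xi,\lambda},\tau_{\eta,\nu})=1$. Moreover, a basis is given by the operator with distribution kernel $$K(x,y,z)=\sum_{j=0}^{\min(n_1,n_2)}(-1)^j\,\frac{(-n_1)_j\,(\lambda_3-\lambda_2-n_1)_j}{j!}\;\delta^{(n_2-j)}(x)\,\delta^{(n_1-j)}(y)\,\delta^{(j)}(z),$$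 that is, by $$Tf(h)=\left\langle K(x,y,z),\,f\!\left(hx_0\begin{pmatrix}1&0&0\\x&1&0\\z&y&1\end{pmatrix}\right)\right\rangle\qquad(h\in H).$$ Here $(s)_j=s(s+1)\cdots(s+j-1)$ and $\langle\delta^{(a)}(x)\delta^{(b)}(y)\delta^{(c)}(z),F\rangle=(-1)^{a+b+c}\,\partial_x^a\partial_y^b\partial_z^cF(0,0,0)$. 2. Otherwise $\dim\mathrm{DSBO}_0(\pi_{\xi,\lambda},\tau_{\eta,\nu})=0$. -/

import Mathlib

open scoped ContDiff

noncomputable section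

namespace SymBreak

/-- `GL (n, ℝ)`, with its topology as the group of units of the matrix ring. -/
abbrev GLn (n : ℕ) : Type := Matrix.GeneralLinearGroup (Fin n) ℝ

/-! ### Principal series of `GL (n, ℝ)` -/

/-- The minimal parabolic subgroup `P = MAN` of invertible upper triangular matrices. -/
def borel (n : ℕ) : Subgroup (GLn n) where
  carrier := {g | (g : Matrix (Fin n) (Fin n) ℝ).BlockTriangular id}
  mul_mem' := by
    intro a b ha hb
    simpa using Matrix.BlockTriangular.mul ha hb
  one_mem' := by
    simpa using (Matrix.blockTriangular_one : (1 : Matrix (Fin n) (Fin n) ℝ).BlockTriangular id)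
  inv_mem' := by
    intro a ha
    have : Invertible (a : Matrix (Fin n) (Fin n) ℝ) := a.invertible
    have h := Matrix.blockTriangular_inv_of_blockTriangular
      (M := (a : Matrix (Fin n) (Fin n) ℝ)) (b := id) ha
    simpa [Matrix.coe_units_inv] using h

/-- The extension by zero of a function on `GL (n, ℝ)` to all arrays of `n × n` real numbers. -/
def extendZero {n : ℕ} (f : GLn n → ℂ) (A : Fin n → Fin n → ℝ) : ℂ :=
  if h : (Matrix.of A).det ≠ 0 then
    f (Matrix.GeneralLinearGroup.mkOfDetNeZero (Matrix.of A) h)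
  else 0

/-- Smoothness on `GL (n, ℝ)`, seen as an open subset of `ℝ^(n × n)`. -/
def IsSmooth {n : ℕ} (f : GLn n → ℂ) : Prop :=
  ContDiffOn ℝ ∞ (extendZero f) {A | (Matrix.of A).det ≠ 0}

/-- `|x|_ξ^s = sgn (x)^ξ |x|^s` for `x ≠ 0`. -/
def signedPow (ξ : ZMod 2) (s : ℂ) (x : ℝ) : ℂ :=
  ((Real.sign x : ℝ) : ℂ) ^ ξ.val * ((|x| : ℝ) : ℂ) ^ s

/-- `ρ = ½ (n - 1, n - 3, …, 3 - n, 1 - n)`. -/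
def rho (n : ℕ) (i : Fin n) : ℂ := ((n : ℂ) - 1) / 2 - ((i : ℕ) : ℂ)

/-- The character `man ↦ ξ(m)⁻¹ a^(-lam-ρ)` of `P`; the diagonal of `p = man` is that of `ma`. -/
def inducingFactor (n : ℕ) (ξ : Fin n → ZMod 2) (lam : Fin n → ℂ) (p : GLn n) : ℂ :=
  ∏ i, signedPow (ξ i) (-lam i - rho n i) ((p : Matrix (Fin n) (Fin n) ℝ) i i)

theorem isSmooth_add {n : ℕ} {f g : GLn n → ℂ} (hf : IsSmooth f) (hg : IsSmooth g) :
    IsSmooth (f + g) := by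
  have h : extendZero (f + g) = extendZero f + extendZero g := by
    funext A
    simp only [extendZero, Pi.add_apply]
    split_ifs <;> simp
  rw [IsSmooth, h]
  exact ContDiffOn.add hf hg

theorem isSmooth_smul {n : ℕ} {f : GLn n → ℂ} (c : ℂ) (hf : IsSmooth f) :
    IsSmooth (c • f) := by
  have h : extendZero (c • f) = fun A => c • extendZero f A := by
    funext A
    simp only [extendZero, Pi.smul_apply]
    split_ifs <;> simp
  rw [IsSmooth, h]
  exact ContDiffOn.const_smul c hf

theorem isSmooth_zero {n : ℕ} : IsSmooth (0 : GLn n → ℂ) := by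
  have h : extendZero (0 : GLn n → ℂ) = fun _ => 0 := by
    funext A
    simp [extendZero]
  rw [IsSmooth, h]
  exact contDiffOn_const

theorem isSmooth_translate {n : ℕ} {f : GLn n → ℂ} (g₀ : GLn n) (hf : IsSmooth f) :
    IsSmooth (fun g => f (g₀ * g)) := by
  let φ : (Fin n → Fin n → ℝ) → (Fin n → Fin n → ℝ) :=
    fun A i j => ∑ k, (g₀ : Matrix (Fin n) (Fin n) ℝ) i k * A k j
  have hφ : ∀ A, Matrix.of (φ A) = (g₀ : Matrix (Fin n) (Fin n) ℝ) * Matrix.of A := by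
    intro A
    ext i j
    simp [φ, Matrix.mul_apply]
  have hdet : ∀ A, (Matrix.of A).det ≠ 0 → (Matrix.of (φ A)).det ≠ 0 := by
    intro A hA
    rw [hφ, Matrix.det_mul]
    exact mul_ne_zero g₀.det_ne_zero hA
  have hsm : ContDiff ℝ ∞ φ := by
    refine contDiff_pi.2 fun i => contDiff_pi.2 fun j => ?_
    refine ContDiff.sum fun k _ => ?_
    exact contDiff_const.mul (contDiff_apply_apply ℝ ℝ k j)
  have hcomp : ContDiffOn ℝ ∞ (extendZero f ∘ φ) {A | (Matrix.of A).det ≠ 0} :=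
    ContDiffOn.comp hf hsm.contDiffOn (fun A hA => hdet A hA)
  refine hcomp.congr fun A hA => ?_
  have hA' : (Matrix.of A).det ≠ 0 := hA
  simp only [extendZero, Function.comp_apply, dif_pos hA', dif_pos (hdet A hA')]
  congr 1
  ext i j
  exact (congrFun (congrFun (hφ A) i) j).symm

/-- The space of the principal series `Ind_P^G (ξ ⊗ e^lam ⊗ 1)` (smooth normalized induction). -/
def principalSeries (n : ℕ) (ξ : Fin n → ZMod 2) (lam : Fin n → ℂ) :
    Submodule ℂ (GLn n → ℂ) where
  carrier := {f | IsSmooth f ∧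
    ∀ g, ∀ p ∈ borel n, f (g * p) = inducingFactor n ξ lam p * f g}
  add_mem' := by
    rintro f g ⟨hf, hf'⟩ ⟨hg, hg'⟩
    refine ⟨isSmooth_add hf hg, fun x p hp => ?_⟩
    simp only [Pi.add_apply, hf' x p hp, hg' x p hp]
    ring
  zero_mem' := ⟨isSmooth_zero, fun x p _ => by simp⟩
  smul_mem' := by
    rintro c f ⟨hf, hf'⟩
    refine ⟨isSmooth_smul c hf, fun x p hp => ?_⟩
    simp only [Pi.smul_apply, smul_eq_mul, hf' x p hp]
    ring

/-- The left regular representation `(g₀ · f)(g) = f (g₀⁻¹ g)` on the principal series. -/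
def principalSeriesRep (n : ℕ) (ξ : Fin n → ZMod 2) (lam : Fin n → ℂ) :
    Representation ℂ (GLn n) (principalSeries n ξ lam) where
  toFun g₀ :=
    { toFun := fun f => ⟨fun g => (f : GLn n → ℂ) (g₀⁻¹ * g), isSmooth_translate g₀⁻¹ f.2.1,
        fun g p hp => by simpa [mul_assoc] using f.2.2 (g₀⁻¹ * g) p hp⟩
      map_add' := fun _ _ => rfl
      map_smul' := fun _ _ => rfl }
  map_one' := by
    ext f g
    simp
  map_mul' := by
    intro a b
    ext f g
    simp [mul_assoc]

/-- The support, in the flag manifold `G / P`, of a function on `G` regarded as a section of a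
line bundle over `G / P`. -/
def sectionSupport {n : ℕ} (f : GLn n → ℂ) : Set (GLn n ⧸ borel n) :=
  closure ((fun g : GLn n => (g : GLn n ⧸ borel n)) '' Function.support f)

/-! ### The pair `(GL (3, ℝ), GL (2, ℝ))` -/

/-- `h ↦ diag (h, 1)` on matrices. -/
def blockHom : Matrix (Fin 2) (Fin 2) ℝ →* Matrix (Fin 3) (Fin 3) ℝ where
  toFun h := !![h 0 0, h 0 1, 0; h 1 0, h 1 1, 0; 0, 0, 1]
  map_one' := by
    ext i j
    fin_cases i <;> fin_cases j <;> simp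
  map_mul' a b := by
    ext i j
    fin_cases i <;> fin_cases j <;> simp [Matrix.mul_apply, Fin.sum_univ_succ]

/-- The embedding `h ↦ diag (h, 1)` of `H = GL (2, ℝ)` in `G = GL (3, ℝ)`. -/
def embed : GLn 2 →* GLn 3 := Units.map blockHom

/-- The permutation matrix `x₀`. -/
def x0 : GLn 3 :=
  Matrix.GeneralLinearGroup.mkOfDetNeZero !![0, 1, 0; 0, 0, 1; 1, 0, 0]
    (by simp [Matrix.det_fin_three])

/-- The coordinates on the group of lower triangular unipotent matrices. -/
def nbar (x y z : ℝ) : GLn 3 :=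
  Matrix.GeneralLinearGroup.mkOfDetNeZero !![1, 0, 0; x, 1, 0; z, y, 1]
    (by simp [Matrix.det_fin_three])

theorem conj_x0_mem (p : GLn 2) (hp : p ∈ borel 2) : x0⁻¹ * embed p * x0 ∈ borel 3 := by
  have h10 : (p : Matrix (Fin 2) (Fin 2) ℝ) 1 0 = 0 := hp (by simp : id (0 : Fin 2) < id 1)
  have hdet : (p : Matrix (Fin 2) (Fin 2) ℝ).det ≠ 0 := p.det_ne_zero
  rw [Matrix.det_fin_two, h10] at hdet
  let q : GLn 3 := Matrix.GeneralLinearGroup.mkOfDetNeZero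
    !![1, 0, 0; 0, (p : Matrix (Fin 2) (Fin 2) ℝ) 0 0, (p : Matrix (Fin 2) (Fin 2) ℝ) 0 1;
      0, 0, (p : Matrix (Fin 2) (Fin 2) ℝ) 1 1]
    (by simpa [Matrix.det_fin_three] using hdet)
  have hq : q ∈ borel 3 := by
    intro i j hij
    fin_cases i <;> fin_cases j <;> first | rfl | exact absurd hij (by decide)
  have hxq : embed p * x0 = x0 * q := by
    ext i j
    fin_cases i <;> fin_cases j <;>
      simp [embed, blockHom, x0, q, Matrix.GeneralLinearGroup.mkOfDetNeZero, Matrix.mul_apply,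
        Fin.sum_univ_succ, h10]
  rw [mul_assoc, hxq, inv_mul_cancel_left]
  exact hq

/-- The `H`-equivariant map `p₀ : H / P_H → G / P_G`, `h P_H ↦ h x₀ P_G`. -/
def p0 : GLn 2 ⧸ borel 2 → GLn 3 ⧸ borel 3 :=
  Quotient.lift (fun h : GLn 2 => ((embed h * x0 : GLn 3) : GLn 3 ⧸ borel 3)) (by
    intro a b hab
    rw [← Quotient.eq_iff_equiv] at hab
    have hab' : a⁻¹ * b ∈ borel 2 := QuotientGroup.eq.1 hab
    refine QuotientGroup.eq.2 ?_
    have h := conj_x0_mem _ hab'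
    simpa [mul_assoc] using h)

theorem sectionSupport_add {n : ℕ} (f g : GLn n → ℂ) :
    sectionSupport (f + g) ⊆ sectionSupport f ∪ sectionSupport g := by
  rw [sectionSupport, sectionSupport, sectionSupport, ← closure_union, ← Set.image_union]
  exact closure_mono (Set.image_mono (Function.support_add f g))

theorem sectionSupport_smul {n : ℕ} (c : ℂ) (f : GLn n → ℂ) :
    sectionSupport (c • f) ⊆ sectionSupport f :=
  closure_mono (Set.image_mono (Function.support_const_smul_subset c f))

/-- The space `DSBO₀ (π_{ξ,lam}, τ_{η,ν})`: linear maps `T` that intertwine the actions of `H` and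
are `p₀`-differential, that is, `p₀ (supp T f) ⊆ supp f` for all `f`. -/
def DSBO0 (ξ : Fin 3 → ZMod 2) (lam : Fin 3 → ℂ) (η : Fin 2 → ZMod 2) (ν : Fin 2 → ℂ) :
    Submodule ℂ (principalSeries 3 ξ lam →ₗ[ℂ] principalSeries 2 η ν) where
  carrier := {T |
    (∀ (h : GLn 2) (f : principalSeries 3 ξ lam),
      T (principalSeriesRep 3 ξ lam (embed h) f) = principalSeriesRep 2 η ν h (T f)) ∧
    ∀ f : principalSeries 3 ξ lam,
      p0 '' sectionSupport (T f : GLn 2 → ℂ) ⊆ sectionSupport (f : GLn 3 → ℂ)}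
  add_mem' := by
    rintro S T ⟨hS, hS'⟩ ⟨hT, hT'⟩
    refine ⟨fun h f => by simp [hS, hT], fun f => ?_⟩
    refine (Set.image_mono (sectionSupport_add _ _)).trans ?_
    rw [Set.image_union]
    exact Set.union_subset (hS' f) (hT' f)
  zero_mem' := by
    refine ⟨fun h f => by simp, fun f => ?_⟩
    simp [sectionSupport]
  smul_mem' := by
    rintro c T ⟨hT, hT'⟩
    refine ⟨fun h f => by simp [hT], fun f => ?_⟩
    exact (Set.image_mono (sectionSupport_smul c _)).trans (hT' f)

/-- The pairing of `δ^(a)(x) δ^(b)(y) δ^(c)(z)` with a smooth function `F` on `ℝ³`, namely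
`(-1)^(a+b+c) ∂_x^a ∂_y^b ∂_z^c F (0)`. -/
def deltaPairing (a b c : ℕ) (F : ℝ → ℝ → ℝ → ℂ) : ℂ :=
  (-1) ^ (a + b + c) *
    iteratedDeriv a (fun x => iteratedDeriv b (fun y => iteratedDeriv c (fun z => F x y z) 0) 0) 0

/-- The coefficient `(-1)^j (-n₁)_j (lam₃ - lam₂ - n₁)_j / j!`, where `(s)_j = s (s+1) ⋯ (s+j-1)`. -/
def kernelCoeff (lam : Fin 3 → ℂ) (n₁ j : ℕ) : ℂ :=
  (-1) ^ j * (ascPochhammer ℂ j).eval (-(n₁ : ℂ)) *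
    (ascPochhammer ℂ j).eval (lam 2 - lam 1 - (n₁ : ℂ)) / (j.factorial : ℂ)

/-- The operator with the distribution kernel
`K (x₀ n̄(x,y,z)) = ∑_j c_j δ^(n₂-j)(x) δ^(n₁-j)(y) δ^(j)(z)`, `0 ≤ j ≤ min n₁ n₂`: its value
at `h` is the pairing of this kernel with the function `n̄ ↦ f (h x₀ n̄)`. -/
def kernelOperator (lam : Fin 3 → ℂ) (n₁ n₂ : ℕ) (f : GLn 3 → ℂ) (h : GLn 2) : ℂ :=
  ∑ j ∈ Finset.range (min n₁ n₂ + 1),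
    kernelCoeff lam n₁ j *
      deltaPairing (n₂ - j) (n₁ - j) j (fun x y z => f (embed h * x0 * nbar x y z))

/-- The integrality and parity conditions, with `lam₃ - ν₂ - ½ = n₁` and
`lam₂ + lam₃ - ν₁ - ν₂ - 1 = n₂` natural numbers (the indices in the code start at `0`). -/
def DSBO0Condition (ξ : Fin 3 → ZMod 2) (lam : Fin 3 → ℂ) (η : Fin 2 → ZMod 2) (ν : Fin 2 → ℂ)
    (n₁ n₂ : ℕ) : Prop :=
  lam 2 - ν 1 - 1 / 2 = (n₁ : ℂ) ∧
  lam 1 + lam 2 - ν 0 - ν 1 - 1 = (n₂ : ℂ) ∧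
  (n₁ ≤ n₂ ∨ ∃ k₀ : ℕ, k₀ ≤ n₂ ∧ lam 2 - lam 1 - (n₁ : ℂ) + (k₀ : ℂ) = 0) ∧
  η 0 = ξ 1 + ((n₁ + n₂ : ℕ) : ZMod 2) ∧
  η 1 = ξ 2 + (n₁ : ZMod 2)

end SymBreak

end

open scoped Topology

noncomputable section

namespace SymBreak

/-! ### Smooth functions on `ℝ³` -/

/-! By equivariance and locality, an operator `T` in `DSBO0` is determined by one functional `L` on
smooth germs at the origin of the chart `v ↦ x₀ n̄(v)`: `T f (h)` is `L` applied to `v ↦ f (h x₀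
n̄(v))` (`map_apply_eq`). Intertwining leaves the condition that `L` transforms by the inducing
character under the upper triangular subgroup of `GL (2, ℝ)`, which acts on germs through a torus of
dilations and a unipotent group (`Smooth.IsEquivariant`).

`T` is not assumed continuous, so the structure theorem for distributions supported at a point does
not apply to `L`. The torus replaces it. If `L` scales by `c` under a weakly contracting dilation
and `M` is a monomial scaled by `μ` with `|μ| < |c|`, then `L (M * φ) = 0` for every smooth `φ`:
solve `φ = Φ - (μ / c) Φ ∘ A` by a geometric series (`Smooth.map_mul_eq_zero_of_contracting`). With
Hadamard's lemma, `L` is then determined by its values on monomials `X^i Y^j Z^k`. A nonzero value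
forces `j + k = n₁`, `i + k = n₂` and the two parity conditions (`Smooth.IsEquivariant.weight`).

One unipotent element gives a two-term recursion along these monomials
(`Smooth.IsEquivariant.recursion`). Since the coefficient `i` is nonzero until `Z` has exhausted
`X`, the value on `X^n₂ Y^n₁` determines all others, so the dimension is at most one. If `n₂ < n₁`,
the recursion has an additional equation with `i = 0`; run backwards from there, it kills `L` unless
one of the factors `λ₃ - λ₂ - n₁ + k`, `0 ≤ k ≤ n₂`, vanishes.

Conversely, the coefficients of the kernel solve the dual recursion, so the infinitesimal unipotent
action on the kernel telescopes to zero (`Smooth.kernelFunctional_invariant`). Integrating along the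
one-parameter group gives invariance under the unipotent group
(`kernelFunctional_restrict_unipotentTwo`); the torus condition is homogeneity together with parity.
-/

theorem contDiff_parametric_fderiv {F : Type} [NormedAddCommGroup F] [NormedSpace ℝ F]
    {E : Type} [NormedAddCommGroup E] [NormedSpace ℝ E]
    {G : ℝ × E → F} (hG : ContDiff ℝ ∞ G) :
    ContDiff ℝ ∞ (fun p => (fderiv ℝ G p).comp (ContinuousLinearMap.inr ℝ ℝ E)) :=
  (hG.fderiv_right (m := ∞) (by simp)).clm_comp contDiff_const

/-- Differentiation under the integral sign. The derivative is bounded on the compact set `[0, 1] ×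
closedBall v 1`, which supplies a constant dominating function. -/
theorem hasFDerivAt_integral_of_contDiff {F : Type} [NormedAddCommGroup F] [NormedSpace ℝ F]
    [CompleteSpace F] {E : Type} [NormedAddCommGroup E] [NormedSpace ℝ E] [ProperSpace E]
    {G : ℝ × E → F} (hG : ContDiff ℝ ∞ G) (v : E) :
    HasFDerivAt (fun v => ∫ t in (0 : ℝ)..1, G (t, v))
      (∫ t in (0 : ℝ)..1, (fderiv ℝ G (t, v)).comp (ContinuousLinearMap.inr ℝ ℝ E)) v := by
  have hG' := (contDiff_parametric_fderiv hG).continuous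
  obtain ⟨C, hC⟩ := ((isCompact_Icc (a := (0 : ℝ)) (b := 1)).prod
    (isCompact_closedBall v 1)).exists_bound_of_continuousOn hG'.continuousOn
  refine (intervalIntegral.hasFDerivAt_integral_of_dominated_of_fderiv_le
    (bound := fun _ => C) (Metric.ball_mem_nhds v one_pos)
    (F' := fun v t => (fderiv ℝ G (t, v)).comp (ContinuousLinearMap.inr ℝ ℝ E))
    ?_ ?_ ?_ ?_ ?_ ?_)
  · exact Filter.Eventually.of_forall fun w =>
      (hG.continuous.comp (by fun_prop : Continuous fun t : ℝ => (t, w))).aestronglyMeasurable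
  · exact (hG.continuous.comp
      (by fun_prop : Continuous fun t : ℝ => (t, v))).intervalIntegrable _ _
  · exact (hG'.comp (by fun_prop : Continuous fun t : ℝ => (t, v))).aestronglyMeasurable
  · refine Filter.Eventually.of_forall fun t ht w hw => hC (t, w)
      ⟨?_, Metric.ball_subset_closedBall hw⟩
    rw [Set.uIoc_of_le zero_le_one] at ht
    exact ⟨ht.1.le, ht.2⟩
  · exact intervalIntegrable_const
  · refine Filter.Eventually.of_forall fun t _ w _ => ?_
    have h1 : HasFDerivAt G (fderiv ℝ G (t, w)) (t, w) :=
      (hG.differentiable (by simp) _).hasFDerivAt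
    exact h1.comp w (hasFDerivAt_prodMk_right t w)

/-- The derivative is an integral of the same kind with values in a space of linear maps, so the
target `F` has to vary in the induction. -/
theorem contDiff_integral {E : Type} [NormedAddCommGroup E] [NormedSpace ℝ E] [ProperSpace E]
    (n : ℕ) : ∀ {F : Type} [NormedAddCommGroup F] [NormedSpace ℝ F] [CompleteSpace F]
    {G : ℝ × E → F}, ContDiff ℝ ∞ G → ContDiff ℝ n (fun v => ∫ t in (0 : ℝ)..1, G (t, v)) := by
  induction n with
  | zero =>
    intro F _ _ _ G hG
    have : Differentiable ℝ (fun v => ∫ t in (0 : ℝ)..1, G (t, v)) :=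
      fun v => (hasFDerivAt_integral_of_contDiff hG v).differentiableAt
    exact contDiff_zero.2 this.continuous
  | succ n ih =>
    intro F _ _ _ G hG
    rw [show ((n + 1 : ℕ) : WithTop ℕ∞) = n + 1 by norm_cast,
      contDiff_succ_iff_hasFDerivAt]
    exact ⟨_, ih (contDiff_parametric_fderiv hG), fun v => hasFDerivAt_integral_of_contDiff hG v⟩

/-- The algebra of smooth complex functions on `ℝ³`, whose points are written `(x, y, z)`. -/
def Smooth : Subalgebra ℂ (ℝ × ℝ × ℝ → ℂ) where
  carrier := {φ | ContDiff ℝ ∞ φ}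
  mul_mem' := by
    intro a b (ha : ContDiff ℝ ∞ a) (hb : ContDiff ℝ ∞ b)
    exact ha.mul hb
  add_mem' := by
    intro a b (ha : ContDiff ℝ ∞ a) (hb : ContDiff ℝ ∞ b)
    exact ha.add hb
  algebraMap_mem' := fun c =>
    (contDiff_const : ContDiff ℝ ∞ fun _ : ℝ × ℝ × ℝ => c)

namespace Smooth

theorem contDiff (φ : Smooth) : ContDiff ℝ ∞ φ.1 := φ.2

theorem differentiable (φ : Smooth) : Differentiable ℝ φ.1 :=
  (contDiff φ).differentiable (by simp)

def X : Smooth := ⟨fun v => (v.1 : ℂ), show ContDiff ℝ ∞ _ from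
    Complex.ofRealCLM.contDiff.comp contDiff_fst⟩

def Y : Smooth :=
  ⟨fun v => (v.2.1 : ℂ), show ContDiff ℝ ∞ _ from
    Complex.ofRealCLM.contDiff.comp (contDiff_fst.comp contDiff_snd)⟩

def Z : Smooth :=
  ⟨fun v => (v.2.2 : ℂ), show ContDiff ℝ ∞ _ from
    Complex.ofRealCLM.contDiff.comp (contDiff_snd.comp contDiff_snd)⟩

/-- The derivative in the constant direction `w`. -/
def D (w : ℝ × ℝ × ℝ) : Smooth →ₗ[ℂ] Smooth where
  toFun φ := ⟨fun v => fderiv ℝ φ.1 v w,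
    show ContDiff ℝ ∞ _ from
      ((contDiff φ).fderiv_right (m := ∞) (by simp)).clm_apply contDiff_const⟩
  map_add' φ ψ := by
    ext v
    simp [fderiv_add (differentiable φ v) (differentiable ψ v)]
  map_smul' c φ := by
    ext v
    simp [fderiv_const_smul (differentiable φ v) c]

theorem D_apply (w : ℝ × ℝ × ℝ) (φ : Smooth) (v : ℝ × ℝ × ℝ) :
    (D w φ).1 v = fderiv ℝ φ.1 v w := rfl

theorem D_mul (w : ℝ × ℝ × ℝ) (φ ψ : Smooth) : D w (φ * ψ) = D w φ * ψ + φ * D w ψ := by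
  ext v
  simp only [D_apply, Subalgebra.coe_mul, Subalgebra.coe_add, Pi.mul_apply, Pi.add_apply]
  rw [fderiv_mul (differentiable φ v) (differentiable ψ v)]
  simp
  ring

theorem D_comm (w w' : ℝ × ℝ × ℝ) (φ : Smooth) : D w (D w' φ) = D w' (D w φ) := by
  ext v
  have key : ∀ a b, (D a (D b φ)).1 v = fderiv ℝ (fderiv ℝ φ.1) v a b := by
    intro a b
    rw [D_apply]
    change fderiv ℝ (fun v => fderiv ℝ φ.1 v b) v a = _
    have h : DifferentiableAt ℝ (fderiv ℝ φ.1) v :=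
      ((contDiff φ).fderiv_right (m := ∞) (by simp)).differentiable (by simp) v
    rw [fderiv_clm_apply h (differentiableAt_const b)]
    simp
  rw [key, key]
  exact (((contDiff φ).contDiffAt (x := v)).isSymmSndFDerivAt
    (by simpa using WithTop.coe_le_coe.2 (le_top : (2 : ℕ∞) ≤ ⊤))).eq w w'

theorem D_X (w : ℝ × ℝ × ℝ) : D w X = algebraMap ℂ Smooth w.1 := by
  ext v
  change fderiv ℝ (Complex.ofRealCLM ∘L ContinuousLinearMap.fst ℝ ℝ (ℝ × ℝ)) v w = w.1
  rw [ContinuousLinearMap.fderiv]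
  rfl

theorem D_Y (w : ℝ × ℝ × ℝ) : D w Y = algebraMap ℂ Smooth w.2.1 := by
  ext v
  change fderiv ℝ (Complex.ofRealCLM ∘L ContinuousLinearMap.fst ℝ ℝ ℝ ∘L
    ContinuousLinearMap.snd ℝ ℝ (ℝ × ℝ)) v w = w.2.1
  rw [ContinuousLinearMap.fderiv]
  rfl

theorem D_Z (w : ℝ × ℝ × ℝ) : D w Z = algebraMap ℂ Smooth w.2.2 := by
  ext v
  change fderiv ℝ (Complex.ofRealCLM ∘L ContinuousLinearMap.snd ℝ ℝ ℝ ∘L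
    ContinuousLinearMap.snd ℝ ℝ (ℝ × ℝ)) v w = w.2.2
  rw [ContinuousLinearMap.fderiv]
  rfl

/-- **Hadamard's lemma** in three variables. -/
theorem exists_hadamard (φ : Smooth) :
    ∃ φ₁ φ₂ φ₃ : Smooth,
      φ = algebraMap ℂ Smooth (φ.1 0) + X * φ₁ + Y * φ₂ + Z * φ₃ := by
  have hs : ∀ w, ContDiff ℝ ∞ (fun p : ℝ × ℝ × ℝ × ℝ => (D w φ).1 (p.1 • p.2)) := fun w =>
    (contDiff (D w φ)).comp (contDiff_fst.smul contDiff_snd)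
  -- The Hadamard quotients come from `φ v - φ 0 = ∫₀¹ d/dt φ (t v) dt`.
  let Q : ℝ × ℝ × ℝ → Smooth := fun w => ⟨fun v => ∫ t in (0 : ℝ)..1, (D w φ).1 (t • v),
    show ContDiff ℝ ∞ _ from contDiff_infty.2 fun n => contDiff_integral n (hs w)⟩
  refine ⟨Q (1, 0, 0), Q (0, 1, 0), Q (0, 0, 1), ?_⟩
  ext v
  have hI : ∀ w, IntervalIntegrable (fun t : ℝ => (D w φ).1 (t • v)) MeasureTheory.volume 0 1 :=
    fun w => ((contDiff (D w φ)).continuous.comp (by fun_prop)).intervalIntegrable _ _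
  have hder : ∀ t ∈ Set.uIcc (0 : ℝ) 1,
      HasDerivAt (fun t : ℝ => φ.1 (t • v)) ((D v φ).1 (t • v)) t := by
    intro t _
    have h1 := (differentiable φ (t • v)).hasFDerivAt
    have h2 : HasDerivAt (fun t : ℝ => t • v) v t := by
      simpa using (hasDerivAt_id t).smul_const v
    exact h1.comp_hasDerivAt t h2
  have h0 := intervalIntegral.integral_eq_sub_of_hasDerivAt hder (hI v)
  have hlin : ∀ t : ℝ, (D v φ).1 (t • v) = (v.1 : ℂ) * (D (1, 0, 0) φ).1 (t • v) +
      (v.2.1 : ℂ) * (D (0, 1, 0) φ).1 (t • v) + (v.2.2 : ℂ) * (D (0, 0, 1) φ).1 (t • v) := by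
    intro t
    simp only [D_apply]
    have : v = v.1 • ((1, 0, 0) : ℝ × ℝ × ℝ) + v.2.1 • ((0, 1, 0) : ℝ × ℝ × ℝ)
        + v.2.2 • ((0, 0, 1) : ℝ × ℝ × ℝ) := by
      ext <;> simp
    generalize fderiv ℝ φ.1 (t • v) = l
    conv_lhs => rw [this]
    simp only [map_add, map_smul, Complex.real_smul]
  rw [intervalIntegral.integral_congr (fun t _ => hlin t),
    intervalIntegral.integral_add (((hI _).const_mul _).add ((hI _).const_mul _))
    ((hI _).const_mul _), intervalIntegral.integral_add ((hI _).const_mul _) ((hI _).const_mul _),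
    intervalIntegral.integral_const_mul, intervalIntegral.integral_const_mul,
    intervalIntegral.integral_const_mul, one_smul, zero_smul] at h0
  simp only [Subalgebra.coe_add, Subalgebra.coe_mul, Pi.add_apply, Pi.mul_apply, X, Y, Z, Q]
  have : ((algebraMap ℂ Smooth (φ.1 0)) : ℝ × ℝ × ℝ → ℂ) v = φ.1 0 := rfl
  rw [this, add_assoc, add_assoc, ← add_assoc (_ * _), h0]
  ring

/-- The form in which Hadamard's lemma is iterated on monomials `M`. The value of the `Y`-quotient
at the origin is recorded because the recursion needs one first-order term in `y`. -/
theorem exists_hadamard_mul (M φ : Smooth) :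
    ∃ φ₁ φ₂ φ₃ : Smooth, (M * φ = φ.1 0 • M + M * X * φ₁ + M * Y * φ₂ + M * Z * φ₃) ∧
      φ₂.1 0 = (D (0, 1, 0) φ).1 0 := by
  obtain ⟨a, b, c, h⟩ := exists_hadamard φ
  refine ⟨a, b, c, ?_, ?_⟩
  · conv_lhs => rw [h]
    rw [Algebra.smul_def]
    ring
  · have hc : D (0, 1, 0) (algebraMap ℂ Smooth (φ.1 0)) = 0 := by
      ext v
      change fderiv ℝ (fun _ => φ.1 0) v _ = 0
      simp
    rw [h]
    simp only [map_add, D_mul, hc, D_X, D_Y, D_Z, Subalgebra.coe_add, Subalgebra.coe_mul,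
      Pi.add_apply, Pi.mul_apply]
    simp [X, Y, Z]

end Smooth

/-! ### Dilations and local functionals -/

namespace Smooth

/-- The linear map `(x, y, z) ↦ (α x, β y, γ z)`. -/
def diagCLM (α β γ : ℝ) : ℝ × ℝ × ℝ →L[ℝ] ℝ × ℝ × ℝ :=
  (α • ContinuousLinearMap.id ℝ ℝ).prodMap
    ((β • ContinuousLinearMap.id ℝ ℝ).prodMap (γ • ContinuousLinearMap.id ℝ ℝ))

theorem diagCLM_apply (α β γ : ℝ) (v : ℝ × ℝ × ℝ) :
    diagCLM α β γ v = (α * v.1, β * v.2.1, γ * v.2.2) := rfl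

theorem norm_diagCLM_le {α β γ : ℝ} (hα : |α| ≤ 1) (hβ : |β| ≤ 1) (hγ : |γ| ≤ 1) :
    ‖diagCLM α β γ‖ ≤ 1 := by
  refine ContinuousLinearMap.opNorm_le_bound _ zero_le_one fun v => ?_
  rw [one_mul, diagCLM_apply]
  have h : ∀ {s t : ℝ}, |s| ≤ 1 → ‖s * t‖ ≤ ‖t‖ := by
    intro s t hs
    rw [norm_mul]
    exact mul_le_of_le_one_left (norm_nonneg _) hs
  refine max_le ((h hα).trans (le_max_left _ _)) (max_le ?_ ?_)
  · exact (h hβ).trans ((le_max_left _ _).trans (le_max_right _ _))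
  · exact (h hγ).trans ((le_max_right _ _).trans (le_max_right _ _))

/-- Precomposition with `(x, y, z) ↦ (α x, β y, γ z)`. -/
def dil (α β γ : ℝ) : Smooth →ₐ[ℂ] Smooth where
  toFun φ := ⟨fun v => φ.1 (diagCLM α β γ v),
    show ContDiff ℝ ∞ _ from (contDiff φ).comp (diagCLM α β γ).contDiff⟩
  map_one' := rfl
  map_mul' _ _ := rfl
  map_zero' := rfl
  map_add' _ _ := rfl
  commutes' _ := rfl

theorem dil_apply (α β γ : ℝ) (φ : Smooth) (v : ℝ × ℝ × ℝ) :
    (dil α β γ φ).1 v = φ.1 (α * v.1, β * v.2.1, γ * v.2.2) := rfl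

theorem dil_X (α β γ : ℝ) : dil α β γ X = (α : ℂ) • X := by
  ext v
  simp [dil_apply, X]

theorem dil_Y (α β γ : ℝ) : dil α β γ Y = (β : ℂ) • Y := by
  ext v
  simp [dil_apply, Y]

theorem dil_Z (α β γ : ℝ) : dil α β γ Z = (γ : ℂ) • Z := by
  ext v
  simp [dil_apply, Z]

theorem dil_monomial (α β γ : ℝ) (a b c : ℕ) :
    dil α β γ (X ^ a * Y ^ b * Z ^ c) =
      ((α : ℂ) ^ a * (β : ℂ) ^ b * (γ : ℂ) ^ c) • (X ^ a * Y ^ b * Z ^ c) := by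
  simp only [map_mul, map_pow, dil_X, dil_Y, dil_Z, Algebra.smul_def, mul_pow]
  ring

/-- A cutoff function, supported in the ball of radius `2` and equal to `1` near the origin. -/
def cutBump : ContDiffBump (0 : ℝ × ℝ × ℝ) := ⟨1, 2, one_pos, one_lt_two⟩

def cut : Smooth :=
  ⟨fun v => (cutBump v : ℂ), show ContDiff ℝ ∞ _ from
    Complex.ofRealCLM.contDiff.comp cutBump.contDiff⟩

theorem cut_eventuallyEq : cut.1 =ᶠ[𝓝 0] 1 := by
  filter_upwards [cutBump.eventuallyEq_one] with v hv
  simp [cut, hv]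

theorem cut_eq_zero {v : ℝ × ℝ × ℝ} (hv : 2 ≤ ‖v‖) : cut.1 v = 0 := by
  have : cutBump v = 0 := cutBump.zero_of_le_dist (by simpa [cutBump] using hv)
  simp [cut, this]

theorem cut_mul_eventuallyEq (φ : Smooth) : (cut * φ).1 =ᶠ[𝓝 0] φ.1 := by
  filter_upwards [cut_eventuallyEq] with v hv
  simp [hv]

theorem hasCompactSupport_cut : HasCompactSupport cut.1 := by
  refine HasCompactSupport.intro (isCompact_closedBall (0 : ℝ × ℝ × ℝ) 2) fun v hv => ?_
  refine cut_eq_zero ?_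
  rw [Metric.mem_closedBall, dist_zero_right, not_le] at hv
  exact hv.le

/-- A linear functional that depends only on the germ at the origin. -/
def IsLocal (L : Smooth →ₗ[ℂ] ℂ) : Prop :=
  ∀ φ ψ : Smooth, φ.1 =ᶠ[𝓝 0] ψ.1 → L φ = L ψ

/-- The solution is `Φ = ∑ q^k φ ∘ A^k`, with `A` the dilation. Compact support bounds every
derivative of `φ`, and `‖A‖ ≤ 1` keeps these bounds under composition, so each differentiated series
is dominated by a geometric one. -/
theorem exists_sub_dil_eq {α β γ : ℝ} (hα : |α| ≤ 1) (hβ : |β| ≤ 1) (hγ : |γ| ≤ 1) {q : ℂ}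
    (hq : ‖q‖ < 1) {φ : Smooth} (hφ : HasCompactSupport φ.1) :
    ∃ Φ : Smooth, φ = Φ - q • dil α β γ Φ := by
  have hpow : ∀ {s : ℝ}, |s| ≤ 1 → ∀ k : ℕ, |s ^ k| ≤ 1 := by
    intro s hs k
    rw [abs_pow]
    exact pow_le_one₀ (abs_nonneg s) hs
  have hbound : ∀ n : ℕ, ∃ C, ∀ v, ‖iteratedFDeriv ℝ n φ.1 v‖ ≤ C := fun n =>
    (hφ.iteratedFDeriv n).exists_bound_of_continuous
      ((contDiff φ).continuous_iteratedFDeriv (by exact_mod_cast le_top))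
  choose C hC using hbound
  let g : ℕ → ℝ × ℝ × ℝ → ℂ := fun k v => q ^ k • φ.1 (diagCLM (α ^ k) (β ^ k) (γ ^ k) v)
  have hcomp : ∀ k, ContDiff ℝ ∞ (φ.1 ∘ diagCLM (α ^ k) (β ^ k) (γ ^ k)) := fun k =>
    (contDiff φ).comp (ContinuousLinearMap.contDiff _)
  have hg : ∀ k, ContDiff ℝ ∞ (g k) := fun k => (hcomp k).const_smul (q ^ k)
  have hgb : ∀ (n k : ℕ) (v : ℝ × ℝ × ℝ), ‖iteratedFDeriv ℝ n (g k) v‖ ≤ C n * ‖q‖ ^ k := by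
    intro n k v
    have hn : ((n : ℕ∞) : WithTop ℕ∞) ≤ ∞ := by exact_mod_cast le_top
    have h1 : iteratedFDeriv ℝ n (g k) v =
        q ^ k • iteratedFDeriv ℝ n (φ.1 ∘ diagCLM (α ^ k) (β ^ k) (γ ^ k)) v :=
      iteratedFDeriv_const_smul_apply (a := q ^ k)
        (f := φ.1 ∘ diagCLM (α ^ k) (β ^ k) (γ ^ k)) (((hcomp k).of_le hn).contDiffAt)
    rw [h1, norm_smul, norm_pow, mul_comm]
    refine mul_le_mul_of_nonneg_right ?_ (pow_nonneg (norm_nonneg q) k)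
    rw [ContinuousLinearMap.iteratedFDeriv_comp_right _ (contDiff φ) _ hn]
    refine (ContinuousMultilinearMap.norm_compContinuousLinearMap_le _ _).trans ?_
    refine (mul_le_of_le_one_right (norm_nonneg _) ?_).trans (hC n _)
    exact Finset.prod_le_one (fun _ _ => norm_nonneg _)
      fun _ _ => norm_diagCLM_le (hpow hα k) (hpow hβ k) (hpow hγ k)
  have hsum : ∀ n : ℕ, Summable fun k => C n * ‖q‖ ^ k := fun n =>
    (summable_geometric_of_lt_one (norm_nonneg q) hq).mul_left _
  have hΦ : ContDiff ℝ ∞ (fun v => ∑' k, g k v) :=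
    contDiff_tsum (N := ⊤) (v := fun n k => C n * ‖q‖ ^ k) hg (fun n _ => hsum n)
      fun n k v _ => hgb n k v
  refine ⟨⟨_, hΦ⟩, ?_⟩
  ext v
  have hs : Summable fun k => g k v := by
    refine Summable.of_norm_bounded (hsum 0) fun k => ?_
    have := hgb 0 k v
    rwa [norm_iteratedFDeriv_zero] at this
  change φ.1 v = ∑' k, g k v - q * ∑' k, g k (diagCLM α β γ v)
  rw [hs.tsum_eq_zero_add, ← tsum_mul_left]
  have h0 : g 0 v = φ.1 v := by simp [g, diagCLM_apply]
  have h1 : ∀ k, g (k + 1) v = q * g k (diagCLM α β γ v) := by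
    intro k
    simp only [g, diagCLM_apply, smul_eq_mul, pow_succ, mul_assoc]
    ring
  simp [h0, h1]

/-- Equivariance gives `μ L (M * (Φ ∘ A)) = c L (M * Φ)`, so `L` vanishes on `M * (Φ - (μ / c) Φ ∘
A)`. By locality `φ` may be cut off, and then it has this form. No continuity of `L` enters. -/
theorem map_mul_eq_zero_of_contracting {L : Smooth →ₗ[ℂ] ℂ} (hL : IsLocal L) {α β γ : ℝ}
    (hα : |α| ≤ 1) (hβ : |β| ≤ 1) (hγ : |γ| ≤ 1) {c μ : ℂ} (hμc : ‖μ‖ < ‖c‖)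
    (hdil : ∀ φ, L (dil α β γ φ) = c * L φ) {M : Smooth} (hM : dil α β γ M = μ • M)
    (φ : Smooth) : L (M * φ) = 0 := by
  have hc : c ≠ 0 := norm_pos_iff.1 ((norm_nonneg μ).trans_lt hμc)
  have hq : ‖μ / c‖ < 1 := by
    rw [norm_div]
    exact (div_lt_one (norm_pos_iff.2 hc)).2 hμc
  obtain ⟨Φ, hΦ⟩ := exists_sub_dil_eq hα hβ hγ hq (φ := cut * φ)
    (hasCompactSupport_cut.mul_right)
  have hloc : L (M * φ) = L (M * (cut * φ)) := by
    refine hL _ _ ?_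
    filter_upwards [cut_mul_eventuallyEq φ] with v hv
    rw [Subalgebra.coe_mul, Subalgebra.coe_mul, Pi.mul_apply, Pi.mul_apply, hv]
  have h1 : μ * L (M * dil α β γ Φ) = c * L (M * Φ) := by
    rw [← hdil, map_mul (dil α β γ), hM, smul_mul_assoc, map_smul, smul_eq_mul]
  rw [hloc, hΦ, mul_sub, mul_smul_comm, map_sub, map_smul, smul_eq_mul, div_mul_eq_mul_div, h1]
  field_simp
  ring

/-- Taylor expansion by repeated use of Hadamard's lemma: each step removes a monomial and raises
the degree of the remainder, until `hN` applies. -/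
theorem map_eq_zero_of_monomials {L : Smooth →ₗ[ℂ] ℂ} {N : ℕ}
    (hN : ∀ a b c φ, N ≤ a + b + c → L (X ^ a * Y ^ b * Z ^ c * φ) = 0)
    (hmon : ∀ a b c, L (X ^ a * Y ^ b * Z ^ c) = 0) : L = 0 := by
  suffices h : ∀ m a b c φ, N ≤ a + b + c + m → L (X ^ a * Y ^ b * Z ^ c * φ) = 0 by
    ext φ
    simpa using h N 0 0 0 φ (by omega)
  intro m
  -- `m` bounds the number of degrees still missing before the total degree reaches `N`.
  induction m with
  | zero => exact fun a b c φ h => hN a b c φ h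
  | succ m ih =>
    intro a b c φ h
    obtain ⟨φ₁, φ₂, φ₃, h', -⟩ := exists_hadamard_mul (X ^ a * Y ^ b * Z ^ c) φ
    have e1 := ih (a + 1) b c φ₁ (by omega)
    have e2 := ih a (b + 1) c φ₂ (by omega)
    have e3 := ih a b (c + 1) φ₃ (by omega)
    rw [h', map_add, map_add, map_add, map_smul, hmon, smul_zero, zero_add]
    rw [show X ^ a * Y ^ b * Z ^ c * X * φ₁ = X ^ (a + 1) * Y ^ b * Z ^ c * φ₁ by ring, e1,
      show X ^ a * Y ^ b * Z ^ c * Y * φ₂ = X ^ a * Y ^ (b + 1) * Z ^ c * φ₂ by ring, e2,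
      show X ^ a * Y ^ b * Z ^ c * Z * φ₃ = X ^ a * Y ^ b * Z ^ (c + 1) * φ₃ by ring, e3]
    simp

end Smooth

section

/-! ### Characters of the diagonal subgroup -/

theorem signedPow_one (ξ : ZMod 2) (s : ℂ) : signedPow ξ s 1 = 1 := by
  simp [signedPow]

theorem signedPow_of_pos (ξ : ZMod 2) (s : ℂ) {x : ℝ} (hx : 0 < x) :
    signedPow ξ s x = (x : ℂ) ^ s := by
  simp [signedPow, Real.sign_of_pos hx, abs_of_pos hx]

theorem signedPow_of_pos' (ξ : ZMod 2) (s : ℂ) {x : ℝ} (hx : 0 < x) :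
    signedPow ξ s x = Complex.exp (s * (Real.log x : ℂ)) := by
  rw [signedPow_of_pos ξ s hx, Complex.cpow_def_of_ne_zero (by exact_mod_cast hx.ne'),
    Complex.ofReal_log hx.le, mul_comm]

theorem signedPow_neg (ξ : ZMod 2) (s : ℂ) {x : ℝ} (hx : 0 < x) :
    signedPow ξ s (-x) = (-1) ^ ξ.val * (x : ℂ) ^ s := by
  simp [signedPow, Real.sign_of_neg (neg_neg_of_pos hx), abs_of_pos hx]

theorem signedPow_mul (ξ : ZMod 2) (s : ℂ) (x y : ℝ) :
    signedPow ξ s (x * y) = signedPow ξ s x * signedPow ξ s y := by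
  have h : Real.sign (x * y) = Real.sign x * Real.sign y := by
    rcases lt_trichotomy x 0 with hx | rfl | hx <;> rcases lt_trichotomy y 0 with hy | rfl | hy <;>
      simp [Real.sign_of_neg, Real.sign_of_pos, *, mul_pos_of_neg_of_neg, mul_neg_of_neg_of_pos,
        mul_neg_of_pos_of_neg]
  simp only [signedPow, h, abs_mul, Complex.ofReal_mul, mul_pow,
    Complex.mul_cpow_ofReal_nonneg (abs_nonneg x) (abs_nonneg y)]
  ring

theorem contDiffAt_signedPow (ξ : ZMod 2) (s : ℂ) {x : ℝ} (hx : x ≠ 0) :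
    ContDiffAt ℝ ∞ (signedPow ξ s) x := by
  have hpos : ∀ y : ℝ, 0 < y → ContDiffAt ℝ ∞ (signedPow ξ s) y := by
    intro y hy
    have h1 : ContDiffAt ℝ ∞ (fun t : ℝ => Complex.exp (s * (Real.log t : ℂ))) y := by
      refine ContDiffAt.cexp (contDiffAt_const.mul ?_)
      exact Complex.ofRealCLM.contDiff.contDiffAt.comp y (Real.contDiffAt_log.2 hy.ne')
    refine h1.congr_of_eventuallyEq ?_
    filter_upwards [lt_mem_nhds hy] with t ht using signedPow_of_pos' ξ s ht
  rcases hx.lt_or_gt with hx | hx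
  · have h1 : signedPow ξ s = fun t => signedPow ξ s (-1) * signedPow ξ s (-t) := by
      funext t
      rw [← signedPow_mul]
      simp
    rw [h1]
    exact contDiffAt_const.mul ((hpos (-x) (neg_pos.2 hx)).comp x contDiffAt_id.neg)
  · exact hpos x hx

/-! ### The big cell -/

theorem extendZero_coe {n : ℕ} (f : GLn n → ℂ) (g : GLn n) :
    extendZero f (fun i j => (g : Matrix (Fin n) (Fin n) ℝ) i j) = f g := by
  have h : (Matrix.of fun i j => (g : Matrix (Fin n) (Fin n) ℝ) i j).det ≠ 0 := g.det_ne_zero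
  rw [extendZero, dif_pos h]
  congr 1
  ext i j
  rfl

theorem isSmooth_of_contDiffAt {n : ℕ} (F : (Fin n → Fin n → ℝ) → ℂ)
    (hF : ∀ A, (Matrix.of A).det ≠ 0 → ContDiffAt ℝ ∞ F A) :
    IsSmooth (fun g : GLn n => F fun i j => (g : Matrix (Fin n) (Fin n) ℝ) i j) := by
  refine ContDiffOn.congr (f := F) (fun A hA => (hF A hA).contDiffWithinAt) fun A hA => ?_
  have hA' : (Matrix.of A).det ≠ 0 := hA
  exact dif_pos hA'

/-- The array of the matrix `diag (h, 1) x₀ n̄(v)`. -/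
def cell (A : Fin 2 → Fin 2 → ℝ) (v : ℝ × ℝ × ℝ) : Fin 3 → Fin 3 → ℝ :=
  ![![A 0 0 * v.1 + A 0 1 * v.2.2, A 0 0 + A 0 1 * v.2.1, A 0 1],
    ![A 1 0 * v.1 + A 1 1 * v.2.2, A 1 0 + A 1 1 * v.2.1, A 1 1], ![1, 0, 0]]

theorem coe_embed_mul (h : GLn 2) (x y z : ℝ) :
    (fun i j => ((embed h * x0 * nbar x y z : GLn 3) : Matrix (Fin 3) (Fin 3) ℝ) i j) =
      cell (fun i j => (h : Matrix (Fin 2) (Fin 2) ℝ) i j) (x, y, z) := by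
  funext i j
  fin_cases i <;> fin_cases j <;>
    simp [embed, blockHom, x0, nbar, cell, Matrix.GeneralLinearGroup.mkOfDetNeZero,
      Matrix.mul_apply, Fin.sum_univ_succ]

theorem nbar_zero : nbar 0 0 0 = 1 := by
  ext i j
  fin_cases i <;> fin_cases j <;> rfl

theorem det_cell (A : Fin 2 → Fin 2 → ℝ) (v : ℝ × ℝ × ℝ) :
    (Matrix.of (cell A v)).det = (Matrix.of A).det := by
  simp [cell, Matrix.det_fin_three, Matrix.det_fin_two]
  ring

theorem contDiff_cell :
    ContDiff ℝ ∞ (fun p : (Fin 2 → Fin 2 → ℝ) × ℝ × ℝ × ℝ => cell p.1 p.2) := by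
  refine contDiff_pi.2 fun i => contDiff_pi.2 fun j => ?_
  fin_cases i <;> fin_cases j <;> simp [cell] <;> fun_prop

theorem contDiffOn_extendZero_cell {f : GLn 3 → ℂ} (hf : IsSmooth f) :
    ContDiffOn ℝ ∞ (fun p : (Fin 2 → Fin 2 → ℝ) × ℝ × ℝ × ℝ => extendZero f (cell p.1 p.2))
      ({A | (Matrix.of A).det ≠ 0} ×ˢ Set.univ) := by
  refine ContDiffOn.comp hf contDiff_cell.contDiffOn fun p hp => ?_
  change (Matrix.of (cell p.1 p.2)).det ≠ 0
  rw [det_cell]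
  exact hp.1

theorem isOpen_det_ne_zero (n : ℕ) : IsOpen {A : Fin n → Fin n → ℝ | (Matrix.of A).det ≠ 0} :=
  isOpen_ne_fun (by exact Continuous.matrix_det (by fun_prop)) continuous_const

variable (ξ : Fin 3 → ZMod 2) (lam : Fin 3 → ℂ)

/-- The function `v ↦ f (diag (h, 1) x₀ n̄(v))`. -/
def restrict (h : GLn 2) : principalSeries 3 ξ lam →ₗ[ℂ] Smooth where
  toFun f := ⟨fun v => (f : GLn 3 → ℂ) (embed h * x0 * nbar v.1 v.2.1 v.2.2), by
    change ContDiff ℝ ∞ _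
    have h1 := contDiffOn_extendZero_cell f.2.1
    have h2 : ContDiff ℝ ∞ (fun v : ℝ × ℝ × ℝ =>
      ((fun i j => (h : Matrix (Fin 2) (Fin 2) ℝ) i j : Fin 2 → Fin 2 → ℝ), v)) :=
      contDiff_const.prodMk contDiff_id
    have h3 := h1.comp (h2.contDiffOn (s := Set.univ)) fun v _ => ⟨h.det_ne_zero, trivial⟩
    rw [contDiffOn_univ] at h3
    convert h3 using 1
    funext v
    rw [Function.comp_apply, ← coe_embed_mul, extendZero_coe]⟩
  map_add' _ _ := rfl
  map_smul' _ _ := rfl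

variable {ξ lam}

theorem restrict_apply (h : GLn 2) (f : principalSeries 3 ξ lam) (v : ℝ × ℝ × ℝ) :
    (restrict ξ lam h f).1 v = (f : GLn 3 → ℂ) (embed h * x0 * nbar v.1 v.2.1 v.2.2) := rfl

theorem restrict_rep (h k : GLn 2) (f : principalSeries 3 ξ lam) :
    restrict ξ lam h (principalSeriesRep 3 ξ lam (embed k) f) = restrict ξ lam (k⁻¹ * h) f := by
  ext v
  simp only [restrict_apply, map_mul, map_inv]
  change (f : GLn 3 → ℂ) _ = _
  simp only [mul_assoc]

/-- The second leading minor of `x₀⁻¹ g`. -/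
def minor (A : Fin 3 → Fin 3 → ℝ) : ℝ := A 2 0 * A 0 1 - A 2 1 * A 0 0

/-- The coordinates `v` of `g ∈ x₀ n̄(v) P`. -/
def coord (A : Fin 3 → Fin 3 → ℝ) : ℝ × ℝ × ℝ :=
  (A 0 0 / A 2 0, (A 2 0 * A 1 1 - A 2 1 * A 1 0) / minor A, A 1 0 / A 2 0)

/-- The function on the big cell that is `φ` on `x₀ N̄`, extended by zero. -/
def cellSection (ξ : Fin 3 → ZMod 2) (lam : Fin 3 → ℂ) (φ : ℝ × ℝ × ℝ → ℂ)
    (A : Fin 3 → Fin 3 → ℝ) : ℂ :=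
  open Classical in
  if A 2 0 ≠ 0 ∧ minor A ≠ 0 then
    signedPow (ξ 0) (-lam 0 - rho 3 0) (A 2 0) *
      signedPow (ξ 1) (-lam 1 - rho 3 1) (minor A / A 2 0) *
      signedPow (ξ 2) (-lam 2 - rho 3 2) ((Matrix.of A).det / minor A) * φ (coord A)
  else 0

theorem continuous_minor : Continuous minor := by
  unfold minor
  fun_prop

theorem eventually_cell {A : Fin 3 → Fin 3 → ℝ} (h1 : A 2 0 ≠ 0) (h2 : minor A ≠ 0) :
    ∀ᶠ B in 𝓝 A, B 2 0 ≠ 0 ∧ minor B ≠ 0 :=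
  (ContinuousAt.eventually_ne (g := fun B : Fin 3 → Fin 3 → ℝ => B 2 0)
    (Continuous.continuousAt (by fun_prop)) h1).and
    (continuous_minor.continuousAt.eventually_ne h2)

theorem contDiffAt_coord {A : Fin 3 → Fin 3 → ℝ} (h1 : A 2 0 ≠ 0) (h2 : minor A ≠ 0) :
    ContDiffAt ℝ ∞ coord A := by
  have hd : ContDiffAt ℝ ∞ (fun B : Fin 3 → Fin 3 → ℝ => B 2 0) A := by fun_prop
  have hm : ContDiffAt ℝ ∞ minor A := by unfold minor; fun_prop
  exact (ContDiffAt.div (by fun_prop) hd h1).prodMk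
    ((ContDiffAt.div (by fun_prop) hm h2).prodMk (ContDiffAt.div (by fun_prop) hd h1))

/-- On the big cell this is a product of smooth functions. At an invertible matrix outside the cell
the section vanishes nearby, because the support of `φ` is bounded in the chart and so cannot
accumulate there. -/
theorem contDiffAt_cellSection {φ : ℝ × ℝ × ℝ → ℂ} (hφ : ContDiff ℝ ∞ φ)
    (hφ0 : ∀ v, 2 ≤ ‖v‖ → φ v = 0) {A : Fin 3 → Fin 3 → ℝ} (hA : (Matrix.of A).det ≠ 0) :
    ContDiffAt ℝ ∞ (cellSection ξ lam φ) A := by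
  have hdet : ContDiff ℝ ∞ (fun B : Fin 3 → Fin 3 → ℝ => (Matrix.of B).det) := by
    simp only [Matrix.det_fin_three, Matrix.of_apply]
    fun_prop
  by_cases hc : A 2 0 ≠ 0 ∧ minor A ≠ 0
  · obtain ⟨h1, h2⟩ := hc
    have hm : ContDiff ℝ ∞ minor := by unfold minor; fun_prop
    have hd : ContDiff ℝ ∞ (fun B : Fin 3 → Fin 3 → ℝ => B 2 0) := by fun_prop
    have key : ContDiffAt ℝ ∞ (fun A : Fin 3 → Fin 3 → ℝ =>
        signedPow (ξ 0) (-lam 0 - rho 3 0) (A 2 0) *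
        signedPow (ξ 1) (-lam 1 - rho 3 1) (minor A / A 2 0) *
        signedPow (ξ 2) (-lam 2 - rho 3 2) ((Matrix.of A).det / minor A) * φ (coord A)) A := by
      refine ContDiffAt.mul (ContDiffAt.mul (ContDiffAt.mul ?_ ?_) ?_) ?_
      · exact (contDiffAt_signedPow _ _ h1).comp A hd.contDiffAt
      · exact (contDiffAt_signedPow _ _ (div_ne_zero h2 h1)).comp A
          (hm.contDiffAt.div hd.contDiffAt h1)
      · exact (contDiffAt_signedPow _ _ (div_ne_zero hA h2)).comp A
          (hdet.contDiffAt.div hm.contDiffAt h2)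
      · exact hφ.contDiffAt.comp A (contDiffAt_coord h1 h2)
    refine key.congr_of_eventuallyEq ?_
    filter_upwards [eventually_cell h1 h2] with B hB
    rw [cellSection, if_pos hB]
  -- `S` is closed and contains every point of the cell with coordinates of norm at most `2`; its
  -- inequalities are the coordinate bounds with denominators cleared. The last one bounds `x y -
  -- z`, and `6 = 2 * 2 + 2`. If `A 2 0 = 0` or `minor A = 0`, membership in `S` makes the first
  -- column, or all `2 × 2` minors of the first two columns, vanish, which contradicts `det A ≠ 0`.
  · let S : Set (Fin 3 → Fin 3 → ℝ) := {B | |B 0 0| ≤ 2 * |B 2 0| ∧ |B 1 0| ≤ 2 * |B 2 0| ∧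
      |B 2 0 * B 1 1 - B 2 1 * B 1 0| ≤ 2 * |minor B| ∧
      |B 0 0 * B 1 1 - B 0 1 * B 1 0| ≤ 6 * |minor B|}
    have hmc := continuous_minor
    have hS : IsClosed S := by
      refine IsClosed.and (isClosed_le (by fun_prop) (by fun_prop))
        (IsClosed.and (isClosed_le (by fun_prop) (by fun_prop))
        (IsClosed.and (isClosed_le (by fun_prop) (by fun_prop))
          (isClosed_le (by fun_prop) (by fun_prop))))
    have hAS : A ∉ S := by
      rintro ⟨s1, s2, s3, s4⟩
      apply hA
      rw [not_and_or, not_not, not_not] at hc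
      simp only [Matrix.det_fin_three, Matrix.of_apply]
      rcases hc with h | h
      · rw [h, abs_zero, mul_zero, abs_nonpos_iff] at s1 s2
        rw [h, s1, s2]
        ring
      · rw [h, abs_zero, mul_zero, abs_nonpos_iff] at s3 s4
        unfold minor at h
        linear_combination (A 2 2) * s4 + (-A 1 2) * (-h) + (A 0 2) * (-s3)
    refine (contDiffAt_const (c := (0 : ℂ))).congr_of_eventuallyEq ?_
    filter_upwards [hS.isOpen_compl.mem_nhds hAS] with B hB
    rw [cellSection]
    split_ifs with h
    · obtain ⟨h1, h2⟩ := h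
      have : 2 ≤ ‖coord B‖ := by
        by_contra hlt
        rw [not_le] at hlt
        apply hB
        have hx : |B 0 0 / B 2 0| ≤ 2 := (norm_fst_le (coord B)).trans hlt.le
        have hyz := norm_snd_le (coord B)
        have hy : |(B 2 0 * B 1 1 - B 2 1 * B 1 0) / minor B| ≤ 2 :=
          (norm_fst_le (coord B).2).trans (hyz.trans hlt.le)
        have hz : |B 1 0 / B 2 0| ≤ 2 := (norm_snd_le (coord B).2).trans (hyz.trans hlt.le)
        have hw : |(B 0 0 * B 1 1 - B 0 1 * B 1 0) / minor B| ≤ 6 := by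
          have e : (B 0 0 * B 1 1 - B 0 1 * B 1 0) / minor B = (B 0 0 / B 2 0) *
              ((B 2 0 * B 1 1 - B 2 1 * B 1 0) / minor B) - B 1 0 / B 2 0 := by
            field_simp
            unfold minor
            ring
          rw [e]
          refine (abs_sub _ _).trans ?_
          rw [abs_mul]
          nlinarith [abs_nonneg (B 0 0 / B 2 0),
            abs_nonneg ((B 2 0 * B 1 1 - B 2 1 * B 1 0) / minor B)]
        rw [abs_div, div_le_iff₀ (abs_pos.2 h1)] at hx hz
        rw [abs_div, div_le_iff₀ (abs_pos.2 h2)] at hy hw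
        exact ⟨hx, hz, hy, hw⟩
      rw [hφ0 _ this, mul_zero]
    · rfl

theorem borel_three_apply {p : GLn 3} (hp : p ∈ borel 3) :
    (p : Matrix (Fin 3) (Fin 3) ℝ) 1 0 = 0 ∧ (p : Matrix (Fin 3) (Fin 3) ℝ) 2 0 = 0 ∧
      (p : Matrix (Fin 3) (Fin 3) ℝ) 2 1 = 0 :=
  ⟨hp (by decide : id (0 : Fin 3) < id 1), hp (by decide : id (0 : Fin 3) < id 2),
    hp (by decide : id (1 : Fin 3) < id 2)⟩

theorem mem_borel_three {p : GLn 3} (h10 : (p : Matrix (Fin 3) (Fin 3) ℝ) 1 0 = 0)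
    (h20 : (p : Matrix (Fin 3) (Fin 3) ℝ) 2 0 = 0)
    (h21 : (p : Matrix (Fin 3) (Fin 3) ℝ) 2 1 = 0) : p ∈ borel 3 := by
  intro i j hij
  fin_cases i <;> fin_cases j <;> first | assumption | exact absurd hij (by decide)

theorem borel_three_diag_ne_zero {p : GLn 3} (hp : p ∈ borel 3) :
    (p : Matrix (Fin 3) (Fin 3) ℝ) 0 0 ≠ 0 ∧ (p : Matrix (Fin 3) (Fin 3) ℝ) 1 1 ≠ 0 ∧
      (p : Matrix (Fin 3) (Fin 3) ℝ) 2 2 ≠ 0 := by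
  have h := p.det_ne_zero
  rw [Matrix.det_of_isUpperTriangular hp, Fin.prod_univ_three] at h
  exact ⟨left_ne_zero_of_mul (left_ne_zero_of_mul h), right_ne_zero_of_mul
    (left_ne_zero_of_mul h), right_ne_zero_of_mul h⟩

/-- Right multiplication by an upper triangular `p` multiplies the successive leading minors of
`x₀⁻¹ g` by `p₁₁`, `p₁₁ p₂₂` and `p₁₁ p₂₂ p₃₃` and leaves the coordinates of the cell unchanged. -/
theorem cellSection_mul (φ : ℝ × ℝ × ℝ → ℂ) (g : GLn 3) {p : GLn 3} (hp : p ∈ borel 3) :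
    cellSection ξ lam φ (fun i j => ((g * p : GLn 3) : Matrix (Fin 3) (Fin 3) ℝ) i j) =
      inducingFactor 3 ξ lam p *
        cellSection ξ lam φ (fun i j => (g : Matrix (Fin 3) (Fin 3) ℝ) i j) := by
  obtain ⟨h10, h20, h21⟩ := borel_three_apply hp
  obtain ⟨h0, h1, h2⟩ := borel_three_diag_ne_zero hp
  have hdet : ((g * p : GLn 3) : Matrix (Fin 3) (Fin 3) ℝ).det =
      (g : Matrix (Fin 3) (Fin 3) ℝ).det * ((p : Matrix (Fin 3) (Fin 3) ℝ) 0 0 *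
        (p : Matrix (Fin 3) (Fin 3) ℝ) 1 1 * (p : Matrix (Fin 3) (Fin 3) ℝ) 2 2) := by
    rw [Units.val_mul, Matrix.det_mul, Matrix.det_of_isUpperTriangular hp, Fin.prod_univ_three]
  have e0 : ∀ i, ((g * p : GLn 3) : Matrix (Fin 3) (Fin 3) ℝ) i 0 =
      (g : Matrix (Fin 3) (Fin 3) ℝ) i 0 * (p : Matrix (Fin 3) (Fin 3) ℝ) 0 0 := by
    intro i
    simp [Matrix.mul_apply, Fin.sum_univ_three, h10, h20]
  have e1 : ∀ i, ((g * p : GLn 3) : Matrix (Fin 3) (Fin 3) ℝ) i 1 =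
      (g : Matrix (Fin 3) (Fin 3) ℝ) i 0 * (p : Matrix (Fin 3) (Fin 3) ℝ) 0 1 +
      (g : Matrix (Fin 3) (Fin 3) ℝ) i 1 * (p : Matrix (Fin 3) (Fin 3) ℝ) 1 1 := by
    intro i
    simp [Matrix.mul_apply, Fin.sum_univ_three, h21]
  have hd : ∀ q : GLn 3, (Matrix.of fun i j => (q : Matrix (Fin 3) (Fin 3) ℝ) i j).det =
      (q : Matrix (Fin 3) (Fin 3) ℝ).det := fun _ => rfl
  simp only [cellSection, inducingFactor, Fin.prod_univ_three, hd, hdet, minor, coord, e0, e1]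
  generalize (g : Matrix (Fin 3) (Fin 3) ℝ) = A at *
  generalize A.det = δ at *
  generalize (p : Matrix (Fin 3) (Fin 3) ℝ) = B at *
  have m : A 2 0 * B 0 0 * (A 0 0 * B 0 1 + A 0 1 * B 1 1) -
      (A 2 0 * B 0 1 + A 2 1 * B 1 1) * (A 0 0 * B 0 0) =
      (A 2 0 * A 0 1 - A 2 1 * A 0 0) * (B 0 0 * B 1 1) := by ring
  have m' : A 2 0 * B 0 0 * (A 1 0 * B 0 1 + A 1 1 * B 1 1) -
      (A 2 0 * B 0 1 + A 2 1 * B 1 1) * (A 1 0 * B 0 0) =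
      (A 2 0 * A 1 1 - A 2 1 * A 1 0) * (B 0 0 * B 1 1) := by ring
  rw [m, m']
  generalize A 2 0 * A 0 1 - A 2 1 * A 0 0 = μ
  by_cases hc : A 2 0 ≠ 0 ∧ μ ≠ 0
  · obtain ⟨c1, c2⟩ := hc
    rw [if_pos ⟨mul_ne_zero c1 h0, mul_ne_zero c2 (mul_ne_zero h0 h1)⟩, if_pos ⟨c1, c2⟩,
      mul_div_mul_right _ _ h0, mul_div_mul_right _ _ h0,
      mul_div_mul_right _ _ (mul_ne_zero h0 h1),
      show μ * (B 0 0 * B 1 1) / (A 2 0 * B 0 0) = μ / A 2 0 * B 1 1 by field_simp,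
      show δ * (B 0 0 * B 1 1 * B 2 2) / (μ * (B 0 0 * B 1 1)) = δ / μ * B 2 2 by field_simp,
      signedPow_mul, signedPow_mul, signedPow_mul]
    ring
  · rw [if_neg hc, if_neg, mul_zero]
    rintro ⟨c1, c2⟩
    exact hc ⟨left_ne_zero_of_mul c1, left_ne_zero_of_mul c2⟩

variable (ξ lam) in
/-- The section of the principal series whose restriction to the big cell is `cut * φ`. -/
def ofGerm : Smooth →ₗ[ℂ] principalSeries 3 ξ lam where
  toFun φ := ⟨fun g => cellSection ξ lam (Smooth.cut * φ).1
      fun i j => (g : Matrix (Fin 3) (Fin 3) ℝ) i j,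
    isSmooth_of_contDiffAt _ fun A hA => contDiffAt_cellSection (Smooth.cut * φ).2
      (fun v hv => by simp [Smooth.cut_eq_zero hv]) hA,
    fun g p hp => cellSection_mul _ g hp⟩
  map_add' φ ψ := by
    ext g
    simp only [cellSection, mul_add, Submodule.coe_add, Subalgebra.coe_add, Pi.add_apply]
    split_ifs <;> simp
  map_smul' c φ := by
    ext g
    simp only [cellSection, mul_smul_comm, Submodule.coe_smul, Pi.smul_apply, RingHom.id_apply,
      smul_eq_mul]
    split_ifs
    · change _ * (c * (Smooth.cut * φ).1 _) = _
      ring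
    · simp

theorem restrict_ofGerm (φ : Smooth) : restrict ξ lam 1 (ofGerm ξ lam φ) = Smooth.cut * φ := by
  ext v
  change cellSection ξ lam (Smooth.cut * φ).1 (fun i j =>
    ((embed 1 * x0 * nbar v.1 v.2.1 v.2.2 : GLn 3) : Matrix (Fin 3) (Fin 3) ℝ) i j) = _
  rw [coe_embed_mul, cellSection]
  have hm : minor (cell (fun i j => ((1 : GLn 2) : Matrix (Fin 2) (Fin 2) ℝ) i j) v) = 1 := by
    simp [minor, cell]
  have hco : coord (cell (fun i j => ((1 : GLn 2) : Matrix (Fin 2) (Fin 2) ℝ) i j) v) = v := by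
    simp only [coord, hm]
    simp [cell]
  have hd : (Matrix.of (cell (fun i j => ((1 : GLn 2) : Matrix (Fin 2) (Fin 2) ℝ) i j) v)).det
      = 1 := by
    rw [det_cell]
    exact Matrix.det_one
  rw [show (v.1, v.2.1, v.2.2) = v from rfl, hm, hd, hco]
  have h20 : cell (fun i j => ((1 : GLn 2) : Matrix (Fin 2) (Fin 2) ℝ) i j) v 2 0 = 1 := rfl
  rw [h20, if_pos ⟨one_ne_zero, one_ne_zero⟩]
  simp [signedPow_one]

/-- Gaussian elimination for `x₀⁻¹ g`: nonvanishing of the first two leading minors gives a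
factorization into lower unipotent times upper triangular. -/
theorem exists_eq_mul_borel {g : GLn 3} (h1 : (g : Matrix (Fin 3) (Fin 3) ℝ) 2 0 ≠ 0)
    (h2 : minor (fun i j => (g : Matrix (Fin 3) (Fin 3) ℝ) i j) ≠ 0) :
    ∃ v : ℝ × ℝ × ℝ, v = coord (fun i j => (g : Matrix (Fin 3) (Fin 3) ℝ) i j) ∧
      ∃ q ∈ borel 3, g = embed 1 * x0 * nbar v.1 v.2.1 v.2.2 * q := by
  refine ⟨_, rfl, ?_⟩
  set v := coord (fun i j => (g : Matrix (Fin 3) (Fin 3) ℝ) i j) with hv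
  set b := embed 1 * x0 * nbar v.1 v.2.1 v.2.2 with hb
  refine ⟨b⁻¹ * g, ?_, by simp⟩
  have hbg : (b : Matrix (Fin 3) (Fin 3) ℝ) * ((b⁻¹ * g : GLn 3) : Matrix (Fin 3) (Fin 3) ℝ) =
      (g : Matrix (Fin 3) (Fin 3) ℝ) := by
    rw [← Units.val_mul, mul_inv_cancel_left]
  have hbe : ∀ i j, (b : Matrix (Fin 3) (Fin 3) ℝ) i j =
      cell (fun i j => ((1 : GLn 2) : Matrix (Fin 2) (Fin 2) ℝ) i j) v i j := fun i j =>
    congrFun (congrFun (coe_embed_mul 1 v.1 v.2.1 v.2.2) i) j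
  have hrow : ∀ j, ((b⁻¹ * g : GLn 3) : Matrix (Fin 3) (Fin 3) ℝ) 0 j =
        (g : Matrix (Fin 3) (Fin 3) ℝ) 2 j ∧
      v.1 * ((b⁻¹ * g : GLn 3) : Matrix (Fin 3) (Fin 3) ℝ) 0 j +
        ((b⁻¹ * g : GLn 3) : Matrix (Fin 3) (Fin 3) ℝ) 1 j =
          (g : Matrix (Fin 3) (Fin 3) ℝ) 0 j ∧
      v.2.2 * ((b⁻¹ * g : GLn 3) : Matrix (Fin 3) (Fin 3) ℝ) 0 j +
        v.2.1 * ((b⁻¹ * g : GLn 3) : Matrix (Fin 3) (Fin 3) ℝ) 1 j +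
        ((b⁻¹ * g : GLn 3) : Matrix (Fin 3) (Fin 3) ℝ) 2 j =
          (g : Matrix (Fin 3) (Fin 3) ℝ) 1 j := by
    intro j
    rw [← congrFun (congrFun hbg 2) j, ← congrFun (congrFun hbg 0) j,
      ← congrFun (congrFun hbg 1) j]
    simp only [Matrix.mul_apply, Fin.sum_univ_three, hbe]
    simp [cell]
  obtain ⟨a0, b0, c0⟩ := hrow 0
  obtain ⟨a1, b1, c1⟩ := hrow 1
  have ex : v.1 * (g : Matrix (Fin 3) (Fin 3) ℝ) 2 0 = (g : Matrix (Fin 3) (Fin 3) ℝ) 0 0 :=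
    div_mul_cancel₀ _ h1
  have ez : v.2.2 * (g : Matrix (Fin 3) (Fin 3) ℝ) 2 0 = (g : Matrix (Fin 3) (Fin 3) ℝ) 1 0 :=
    div_mul_cancel₀ _ h1
  have ey : v.2.1 * ((g : Matrix (Fin 3) (Fin 3) ℝ) 2 0 * (g : Matrix (Fin 3) (Fin 3) ℝ) 0 1 -
      (g : Matrix (Fin 3) (Fin 3) ℝ) 2 1 * (g : Matrix (Fin 3) (Fin 3) ℝ) 0 0) =
      (g : Matrix (Fin 3) (Fin 3) ℝ) 2 0 * (g : Matrix (Fin 3) (Fin 3) ℝ) 1 1 -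
      (g : Matrix (Fin 3) (Fin 3) ℝ) 2 1 * (g : Matrix (Fin 3) (Fin 3) ℝ) 1 0 :=
    div_mul_cancel₀ _ h2
  rw [a0] at b0 c0
  rw [a1] at b1 c1
  have q10 : ((b⁻¹ * g : GLn 3) : Matrix (Fin 3) (Fin 3) ℝ) 1 0 = 0 := by linarith
  refine mem_borel_three q10 ?_ ?_
  · rw [q10] at c0
    linarith
  · refine (mul_eq_zero.1 (?_ : (g : Matrix (Fin 3) (Fin 3) ℝ) 2 0 * _ = 0)).resolve_left h1
    linear_combination (g : Matrix (Fin 3) (Fin 3) ℝ) 2 0 * c1 -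
      v.2.1 * (g : Matrix (Fin 3) (Fin 3) ℝ) 2 0 * b1 - ey +
      v.2.1 * (g : Matrix (Fin 3) (Fin 3) ℝ) 2 1 * ex -
      (g : Matrix (Fin 3) (Fin 3) ℝ) 2 1 * ez

/-! ### Locality -/

/-- The cell is open and its coordinates are continuous, so vanishing on the slice `x₀ N̄` spreads
to a neighbourhood in the group by equivariance under `P`. -/
theorem eventually_eq_zero_of_germ {f : principalSeries 3 ξ lam}
    (hf : ∀ᶠ v in 𝓝 0, (restrict ξ lam 1 f).1 v = 0) :
    ∀ᶠ g in 𝓝 (embed 1 * x0), (f : GLn 3 → ℂ) g = 0 := by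
  let ι : GLn 3 → Fin 3 → Fin 3 → ℝ := fun g i j => (g : Matrix (Fin 3) (Fin 3) ℝ) i j
  have hι : Continuous ι := by
    have h : Continuous fun g : GLn 3 => (g : Matrix (Fin 3) (Fin 3) ℝ) := Units.continuous_val
    exact h
  have e : ι (embed 1 * x0) = cell (fun i j => ((1 : GLn 2) : Matrix (Fin 2) (Fin 2) ℝ) i j) 0 := by
    rw [← Prod.mk_zero_zero, ← Prod.mk_zero_zero, ← coe_embed_mul]
    rw [nbar_zero, mul_one]
  have h1 : ι (embed 1 * x0) 2 0 ≠ 0 := by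
    rw [e]
    exact one_ne_zero
  have hm : minor (ι (embed 1 * x0)) ≠ 0 := by
    rw [e]
    simp [minor, cell]
  have hc : coord (ι (embed 1 * x0)) = 0 := by
    rw [e]
    simp [coord, cell]
  have hcont : Filter.Tendsto (fun g => coord (ι g)) (𝓝 (embed 1 * x0)) (𝓝 0) := by
    have := ((contDiffAt_coord h1 hm).continuousAt.comp hι.continuousAt :
      ContinuousAt (coord ∘ ι) (embed 1 * x0))
    rw [ContinuousAt, Function.comp_apply, hc] at this
    exact this
  filter_upwards [hι.continuousAt.eventually (eventually_cell h1 hm), hcont.eventually hf]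
    with g hg hv
  obtain ⟨v, rfl, q, hq, hgq⟩ := exists_eq_mul_borel hg.1 hg.2
  rw [hgq, f.2.2 _ q hq]
  rw [restrict_apply] at hv
  rw [hv, mul_zero]

/-- The projection to the flag manifold is continuous and open, and the zero set of `f` is invariant
under right translation by `P`. Hence supports can be tested on the group. -/
theorem mem_sectionSupport_iff {n : ℕ} {ξ : Fin n → ZMod 2} {lam : Fin n → ℂ}
    (f : principalSeries n ξ lam) (g : GLn n) :
    (g : GLn n ⧸ borel n) ∈ sectionSupport (f : GLn n → ℂ) ↔
      ¬ ∀ᶠ k in 𝓝 g, (f : GLn n → ℂ) k = 0 := by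
  rw [sectionSupport, mem_closure_iff_nhds, ← not_iff_not, not_not]
  push Not
  constructor
  · rintro ⟨t, ht, h⟩
    have h2 : ∀ᶠ k : GLn n in 𝓝 g, (k : GLn n ⧸ borel n) ∈ t :=
      QuotientGroup.continuous_mk.continuousAt.eventually ht
    filter_upwards [h2] with k hk
    by_contra hne
    exact (Set.eq_empty_iff_forall_notMem.1 h _) ⟨hk, k, hne, rfl⟩
  · intro h
    refine ⟨(fun k : GLn n => (k : GLn n ⧸ borel n)) '' {k | (f : GLn n → ℂ) k = 0},
      QuotientGroup.isOpenMap_coe.image_mem_nhds h, ?_⟩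
    rw [Set.eq_empty_iff_forall_notMem]
    rintro _ ⟨⟨a, ha, rfl⟩, b, hb, hab⟩
    have hab' : (a : GLn n ⧸ borel n) = (b : GLn n ⧸ borel n) := hab.symm
    have hp := QuotientGroup.eq.1 hab'
    have := f.2.2 a _ hp
    rw [mul_inv_cancel_left, show (f : GLn n → ℂ) a = 0 from ha, mul_zero] at this
    exact hb this

variable {η : Fin 2 → ZMod 2} {ν : Fin 2 → ℂ}

theorem map_apply_one_eq_zero {T : principalSeries 3 ξ lam →ₗ[ℂ] principalSeries 2 η ν}
    (hT : T ∈ DSBO0 ξ lam η ν) {f : principalSeries 3 ξ lam}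
    (hf : ∀ᶠ v in 𝓝 0, (restrict ξ lam 1 f).1 v = 0) : (T f : GLn 2 → ℂ) 1 = 0 := by
  by_contra hne
  have h1 : ((1 : GLn 2) : GLn 2 ⧸ borel 2) ∈ sectionSupport (T f : GLn 2 → ℂ) :=
    subset_closure ⟨1, hne, rfl⟩
  have h2 := hT.2 f ⟨_, h1, rfl⟩
  have h3 : p0 ((1 : GLn 2) : GLn 2 ⧸ borel 2) =
      ((embed 1 * x0 : GLn 3) : GLn 3 ⧸ borel 3) := rfl
  rw [h3, mem_sectionSupport_iff] at h2
  exact h2 (eventually_eq_zero_of_germ hf)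

/-- The functional `φ ↦ T f (1)` for `f` with germ `φ` along `x₀ N̄`. -/
def germFunctional (T : principalSeries 3 ξ lam →ₗ[ℂ] principalSeries 2 η ν) :
    Smooth →ₗ[ℂ] ℂ :=
  LinearMap.proj (1 : GLn 2) ∘ₗ (principalSeries 2 η ν).subtype ∘ₗ T ∘ₗ ofGerm ξ lam

theorem germFunctional_apply (T : principalSeries 3 ξ lam →ₗ[ℂ] principalSeries 2 η ν)
    (φ : Smooth) : germFunctional T φ = (T (ofGerm ξ lam φ) : GLn 2 → ℂ) 1 := rfl

theorem map_apply_one {T : principalSeries 3 ξ lam →ₗ[ℂ] principalSeries 2 η ν}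
    (hT : T ∈ DSBO0 ξ lam η ν) {f : principalSeries 3 ξ lam} {φ : Smooth}
    (hf : (restrict ξ lam 1 f).1 =ᶠ[𝓝 0] φ.1) :
    (T f : GLn 2 → ℂ) 1 = germFunctional T φ := by
  have h : ∀ᶠ v in 𝓝 0, (restrict ξ lam 1 (f - ofGerm ξ lam φ)).1 v = 0 := by
    filter_upwards [hf, Smooth.cut_mul_eventuallyEq φ] with v h1 h2
    rw [map_sub, restrict_ofGerm]
    change (restrict ξ lam 1 f).1 v - (Smooth.cut * φ).1 v = 0
    rw [h1, h2, sub_self]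
  have h2 := map_apply_one_eq_zero hT h
  rw [map_sub] at h2
  exact sub_eq_zero.1 h2

theorem isLocal_germFunctional {T : principalSeries 3 ξ lam →ₗ[ℂ] principalSeries 2 η ν}
    (hT : T ∈ DSBO0 ξ lam η ν) : Smooth.IsLocal (germFunctional T) := by
  intro φ ψ h
  refine map_apply_one hT ?_
  rw [restrict_ofGerm]
  exact (Smooth.cut_mul_eventuallyEq φ).trans h

/-- Translating `h` to the identity by equivariance reduces the whole operator to one functional on
germs. -/
theorem map_apply_eq {T : principalSeries 3 ξ lam →ₗ[ℂ] principalSeries 2 η ν}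
    (hT : T ∈ DSBO0 ξ lam η ν) (f : principalSeries 3 ξ lam) (h : GLn 2) :
    (T f : GLn 2 → ℂ) h = germFunctional T (restrict ξ lam h f) := by
  have h1 := congrArg (fun u : principalSeries 2 η ν => (u : GLn 2 → ℂ) 1) (hT.1 h⁻¹ f)
  have h2 : (principalSeriesRep 2 η ν h⁻¹ (T f) : GLn 2 → ℂ) 1 = (T f : GLn 2 → ℂ) h := by
    change (T f : GLn 2 → ℂ) (h⁻¹⁻¹ * 1) = _
    simp
  rw [← h2, ← h1]
  refine map_apply_one hT ?_
  rw [restrict_rep, inv_inv, mul_one]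

theorem germFunctional_equivariant
    {T : principalSeries 3 ξ lam →ₗ[ℂ] principalSeries 2 η ν} (hT : T ∈ DSBO0 ξ lam η ν)
    {p : GLn 2} (hp : p ∈ borel 2) (φ : Smooth) :
    germFunctional T (restrict ξ lam p (ofGerm ξ lam φ)) =
      inducingFactor 2 η ν p * germFunctional T φ := by
  rw [← map_apply_eq hT, germFunctional_apply]
  simpa using (T (ofGerm ξ lam φ)).2.2 1 p hp

end

section

variable {ξ : Fin 3 → ZMod 2} {lam : Fin 3 → ℂ} {η : Fin 2 → ZMod 2} {ν : Fin 2 → ℂ}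

/-! ### The Borel subgroup of `GL (2, ℝ)` in coordinates -/

def diagTwo (a b : ℝ) (ha : a ≠ 0) (hb : b ≠ 0) : GLn 2 :=
  Matrix.GeneralLinearGroup.mkOfDetNeZero !![a, 0; 0, b]
    (by simpa [Matrix.det_fin_two] using ⟨ha, hb⟩)

def unipotentTwo (s : ℝ) : GLn 2 :=
  Matrix.GeneralLinearGroup.mkOfDetNeZero !![1, s; 0, 1] (by simp [Matrix.det_fin_two])

theorem mem_borel_two {p : GLn 2} (h : (p : Matrix (Fin 2) (Fin 2) ℝ) 1 0 = 0) : p ∈ borel 2 := by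
  intro i j hij
  fin_cases i <;> fin_cases j <;> first | assumption | exact absurd hij (by decide)

theorem diagTwo_mem (a b : ℝ) (ha : a ≠ 0) (hb : b ≠ 0) : diagTwo a b ha hb ∈ borel 2 :=
  mem_borel_two rfl

theorem unipotentTwo_mem (s : ℝ) : unipotentTwo s ∈ borel 2 := mem_borel_two rfl

theorem unipotentTwo_add (s t : ℝ) : unipotentTwo (s + t) = unipotentTwo s * unipotentTwo t := by
  ext i j
  fin_cases i <;> fin_cases j <;>
    simp [unipotentTwo, Matrix.GeneralLinearGroup.mkOfDetNeZero, Matrix.mul_apply,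
      Fin.sum_univ_succ, add_comm]

theorem unipotentTwo_zero : unipotentTwo 0 = 1 := by
  ext i j
  fin_cases i <;> fin_cases j <;> rfl

theorem inducingFactor_diagTwo (a b : ℝ) (ha : a ≠ 0) (hb : b ≠ 0) :
    inducingFactor 2 η ν (diagTwo a b ha hb) =
      signedPow (η 0) (-ν 0 - 1 / 2) a * signedPow (η 1) (1 / 2 - ν 1) b := by
  have h0 : -ν 0 - rho 2 0 = -ν 0 - 1 / 2 := by
    norm_num [rho]
  have h1 : -ν 1 - rho 2 1 = 1 / 2 - ν 1 := by
    norm_num [rho]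
    ring
  rw [inducingFactor, Fin.prod_univ_two, h0, h1]
  rfl

theorem inducingFactor_unipotentTwo (s : ℝ) :
    inducingFactor 2 η ν (unipotentTwo s) = 1 := by
  rw [inducingFactor, Fin.prod_univ_two]
  change signedPow _ _ 1 * signedPow _ _ 1 = 1
  simp [signedPow_one]

theorem exists_eq_diagTwo_mul {p : GLn 2} (hp : p ∈ borel 2) :
    ∃ a b s, ∃ (ha : a ≠ 0) (hb : b ≠ 0), p = diagTwo a b ha hb * unipotentTwo s := by
  have h10 : (p : Matrix (Fin 2) (Fin 2) ℝ) 1 0 = 0 := hp (by decide : id (0 : Fin 2) < id 1)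
  have hdet := p.det_ne_zero
  rw [Matrix.det_fin_two, h10, mul_zero, sub_zero] at hdet
  have ha := left_ne_zero_of_mul hdet
  refine ⟨_, _, (p : Matrix (Fin 2) (Fin 2) ℝ) 0 1 / (p : Matrix (Fin 2) (Fin 2) ℝ) 0 0,
    ha, right_ne_zero_of_mul hdet, ?_⟩
  ext i j
  fin_cases i <;> fin_cases j <;>
    simp [diagTwo, unipotentTwo, Matrix.GeneralLinearGroup.mkOfDetNeZero, Matrix.mul_apply,
      Fin.sum_univ_succ, h10, mul_div_cancel₀, ha]

theorem inducingFactor_mul {p q : GLn 2} (hp : p ∈ borel 2) (hq : q ∈ borel 2) :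
    inducingFactor 2 η ν (p * q) = inducingFactor 2 η ν p * inducingFactor 2 η ν q := by
  have p10 : (p : Matrix (Fin 2) (Fin 2) ℝ) 1 0 = 0 := hp (by decide : id (0 : Fin 2) < id 1)
  have q10 : (q : Matrix (Fin 2) (Fin 2) ℝ) 1 0 = 0 := hq (by decide : id (0 : Fin 2) < id 1)
  simp only [inducingFactor, Fin.prod_univ_two, Units.val_mul, Matrix.mul_apply,
    Fin.sum_univ_two, p10, q10, mul_zero, zero_mul, add_zero, zero_add, signedPow_mul]
  ring

/-- A diagonal element moves past `x₀ n̄(v)`: it dilates `v` and leaves a diagonal factor in `P`, on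
which `f` transforms by its character. -/
theorem restrict_mul_diagTwo (f : principalSeries 3 ξ lam) (h : GLn 2) (a b : ℝ) (ha : a ≠ 0)
    (hb : b ≠ 0) :
    restrict ξ lam (h * diagTwo a b ha hb) f =
      (signedPow (ξ 1) (-lam 1) a * signedPow (ξ 2) (1 - lam 2) b) •
        Smooth.dil a (b / a) b (restrict ξ lam h f) := by
  let q : GLn 3 := Matrix.GeneralLinearGroup.mkOfDetNeZero !![1, 0, 0; 0, a, 0; 0, 0, b]
    (by simpa [Matrix.det_fin_three] using ⟨ha, hb⟩)
  have hq : q ∈ borel 3 := mem_borel_three rfl rfl rfl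
  have hfac : inducingFactor 3 ξ lam q =
      signedPow (ξ 1) (-lam 1) a * signedPow (ξ 2) (1 - lam 2) b := by
    have h1 : -lam 1 - rho 3 1 = -lam 1 := by
      norm_num [rho]
    have h2 : -lam 2 - rho 3 2 = 1 - lam 2 := by
      norm_num [rho]
      ring
    rw [inducingFactor, Fin.prod_univ_three, h1, h2]
    change signedPow _ _ 1 * signedPow _ _ a * signedPow _ _ b = _
    rw [signedPow_one, one_mul]
  ext v
  have key : embed (diagTwo a b ha hb) * x0 * nbar v.1 v.2.1 v.2.2 =
      x0 * nbar (a * v.1) (b / a * v.2.1) (b * v.2.2) * q := by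
    ext i j
    fin_cases i <;> fin_cases j <;>
      simp [embed, blockHom, x0, nbar, q, diagTwo, Matrix.GeneralLinearGroup.mkOfDetNeZero,
        Matrix.mul_apply, Fin.sum_univ_succ]
    field_simp
  rw [restrict_apply, map_mul, mul_assoc, mul_assoc, ← mul_assoc (embed (diagTwo a b ha hb)), key,
    ← mul_assoc, f.2.2 _ q hq, hfac, ← mul_assoc]
  rfl

/-- The same for a unipotent element, by the factorization `n_s x₀ n̄(x, y, z) = x₀ n̄(x + s z, y /
(1 + s y), z) q`. The diagonal of `q` is `(1, 1 + s y, (1 + s y)⁻¹)`, whence the factor `(1 + s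
y)^(λ₃ - λ₂ - 1)`. -/
theorem restrict_mul_unipotentTwo (f : principalSeries 3 ξ lam) (h : GLn 2) (s : ℝ)
    {v : ℝ × ℝ × ℝ} (hv : 0 < 1 + s * v.2.1) :
    (restrict ξ lam (h * unipotentTwo s) f).1 v =
      Complex.exp ((lam 2 - lam 1 - 1) * (Real.log (1 + s * v.2.1) : ℂ)) *
        (restrict ξ lam h f).1 (v.1 + s * v.2.2, v.2.1 / (1 + s * v.2.1), v.2.2) := by
  let q : GLn 3 := Matrix.GeneralLinearGroup.mkOfDetNeZero
    !![1, 0, 0; 0, 1 + s * v.2.1, s; 0, 0, (1 + s * v.2.1)⁻¹]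
    (by simpa [Matrix.det_fin_three] using hv.ne')
  have hq : q ∈ borel 3 := mem_borel_three rfl rfl rfl
  have hfac : inducingFactor 3 ξ lam q =
      Complex.exp ((lam 2 - lam 1 - 1) * (Real.log (1 + s * v.2.1) : ℂ)) := by
    have h1 : -lam 1 - rho 3 1 = -lam 1 := by
      norm_num [rho]
    have h2 : -lam 2 - rho 3 2 = 1 - lam 2 := by
      norm_num [rho]
      ring
    rw [inducingFactor, Fin.prod_univ_three, h1, h2]
    change signedPow _ _ 1 * signedPow _ _ (1 + s * v.2.1) * signedPow _ _ (1 + s * v.2.1)⁻¹ = _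
    rw [signedPow_one, one_mul, signedPow_of_pos' _ _ hv, signedPow_of_pos' _ _ (inv_pos.2 hv),
      ← Complex.exp_add, Real.log_inv]
    congr 1
    push_cast
    ring
  have key : embed (unipotentTwo s) * x0 * nbar v.1 v.2.1 v.2.2 =
      x0 * nbar (v.1 + s * v.2.2) (v.2.1 / (1 + s * v.2.1)) v.2.2 * q := by
    ext i j
    fin_cases i <;> fin_cases j <;>
      simp [embed, blockHom, x0, nbar, q, unipotentTwo, Matrix.GeneralLinearGroup.mkOfDetNeZero,
        Matrix.mul_apply, Fin.sum_univ_succ]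
    · exact (div_mul_cancel₀ _ hv.ne').symm
    · rw [div_mul_eq_mul_div, inv_eq_one_div, ← add_div, eq_div_iff hv.ne']
      ring
  rw [restrict_apply, map_mul, mul_assoc, mul_assoc, ← mul_assoc (embed (unipotentTwo s)), key,
    ← mul_assoc, f.2.2 _ q hq, hfac, ← mul_assoc]
  rfl

/-! ### Equivariant functionals on germs -/

namespace Smooth

/-- The invariance properties of the functional on germs attached to an intertwining operator. -/
structure IsEquivariant (ξ : Fin 3 → ZMod 2) (lam : Fin 3 → ℂ) (η : Fin 2 → ZMod 2)
    (ν : Fin 2 → ℂ) (L : Smooth →ₗ[ℂ] ℂ) : Prop where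
  isLocal : IsLocal L
  diag : ∀ a b : ℝ, a ≠ 0 → b ≠ 0 → ∀ φ,
    signedPow (ξ 1) (-lam 1) a * signedPow (ξ 2) (1 - lam 2) b * L (dil a (b / a) b φ) =
      signedPow (η 0) (-ν 0 - 1 / 2) a * signedPow (η 1) (1 / 2 - ν 1) b * L φ
  unipotent : ∀ φ ψ : Smooth, (ψ.1 =ᶠ[𝓝 0] fun v =>
    Complex.exp ((lam 2 - lam 1 - 1) * (Real.log (1 + v.2.1) : ℂ)) *
      φ.1 (v.1 + v.2.2, v.2.1 / (1 + v.2.1), v.2.2)) → L ψ = L φ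

end Smooth

theorem isEquivariant_germFunctional
    {T : principalSeries 3 ξ lam →ₗ[ℂ] principalSeries 2 η ν} (hT : T ∈ DSBO0 ξ lam η ν) :
    Smooth.IsEquivariant ξ lam η ν (germFunctional T) where
  isLocal := isLocal_germFunctional hT
  diag a b ha hb φ := by
    rw [← inducingFactor_diagTwo a b ha hb,
      ← germFunctional_equivariant hT (diagTwo_mem a b ha hb),
      ← one_mul (diagTwo a b ha hb), restrict_mul_diagTwo, restrict_ofGerm, map_smul, smul_eq_mul]
    congr 1
    refine isLocal_germFunctional hT _ _ ?_
    have h := (Smooth.diagCLM a (b / a) b).continuous.tendsto 0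
    rw [map_zero] at h
    exact (h.eventually (Smooth.cut_mul_eventuallyEq φ)).mono fun v hv => hv.symm
  unipotent φ ψ h := by
    rw [← one_mul (germFunctional T φ), ← inducingFactor_unipotentTwo (η := η) (ν := ν) 1,
      ← germFunctional_equivariant hT (unipotentTwo_mem 1)]
    refine isLocal_germFunctional hT _ _ (h.trans ?_)
    have hpos : ∀ᶠ v : ℝ × ℝ × ℝ in 𝓝 0, 0 < 1 + 1 * v.2.1 :=
      ContinuousAt.eventually_lt (by fun_prop) (by fun_prop) (by simp)
    have hcont : Filter.Tendsto
        (fun v : ℝ × ℝ × ℝ => (v.1 + v.2.2, v.2.1 / (1 + v.2.1), v.2.2)) (𝓝 0) (𝓝 0) := by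
      have : ContinuousAt
          (fun v : ℝ × ℝ × ℝ => (v.1 + v.2.2, v.2.1 / (1 + v.2.1), v.2.2)) 0 := by
        refine ContinuousAt.prodMk (by fun_prop) (ContinuousAt.prodMk ?_ (by fun_prop))
        exact ContinuousAt.div (by fun_prop) (by fun_prop) (by simp)
      convert this.tendsto using 2
      simp
      rfl
    filter_upwards [hpos, hcont.eventually (Smooth.cut_mul_eventuallyEq φ)] with v hv hc
    rw [← one_mul (unipotentTwo 1), restrict_mul_unipotentTwo _ _ _ hv, restrict_ofGerm]
    simp only [one_mul]
    rw [hc]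

end

/-! ### Weights and vanishing for equivariant functionals -/

namespace Smooth

variable {ξ : Fin 3 → ZMod 2} {lam : Fin 3 → ℂ} {η : Fin 2 → ZMod 2} {ν : Fin 2 → ℂ}
  {L : Smooth →ₗ[ℂ] ℂ}

/-- The derivative of `a ↦ a^s` at `1` is `s`. -/
theorem cpow_exponent_injective {s t : ℂ} (h : ∀ a : ℝ, 0 < a → (a : ℂ) ^ s = (a : ℂ) ^ t) :
    s = t := by
  have key : ∀ s : ℂ, HasDerivAt (fun a : ℝ => Complex.exp (s * (Real.log a : ℂ))) s 1 := by
    intro s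
    have h1 := (((Real.hasDerivAt_log one_ne_zero).ofReal_comp).const_mul s).cexp
    simpa using h1
  refine (key s).unique ((key t).congr_of_eventuallyEq ?_)
  filter_upwards [lt_mem_nhds one_pos] with a ha
  rw [← signedPow_of_pos' 0 s ha, ← signedPow_of_pos' 0 t ha, signedPow_of_pos _ _ ha,
    signedPow_of_pos _ _ ha, h a ha]

theorem norm_half_pow_lt {s : ℂ} {n : ℕ} (h : s.re < n) :
    ‖((1 / 2 : ℝ) : ℂ) ^ n‖ < ‖((1 / 2 : ℝ) : ℂ) ^ s‖ := by
  rw [Complex.norm_cpow_eq_rpow_re_of_pos (by norm_num), norm_pow, Complex.norm_real,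
    Real.norm_of_nonneg (by norm_num), ← Real.rpow_natCast]
  exact Real.rpow_lt_rpow_of_exponent_gt (by norm_num) (by norm_num) h

/-- The element `diag (1, 1/2)` contracts `y` and `z` and fixes `x`; `L` scales under this
contraction with exponent `λ₃ - ν₂ - 1/2`. -/
theorem IsEquivariant.map_mul_eq_zero_of_lt (hL : IsEquivariant ξ lam η ν L) {b c : ℕ}
    (h : (lam 2 - ν 1 - 1 / 2).re < ((b + c : ℕ) : ℝ)) (φ : Smooth) :
    L (Y ^ b * Z ^ c * φ) = 0 := by
  have hr : (0 : ℝ) < 1 / 2 := by norm_num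
  have hr' : ((1 / 2 : ℝ) : ℂ) ≠ 0 := by exact_mod_cast hr.ne'
  refine map_mul_eq_zero_of_contracting hL.isLocal (α := 1) (β := 1 / 2) (γ := 1 / 2) (by simp)
    (by rw [abs_of_pos hr]; norm_num) (by rw [abs_of_pos hr]; norm_num) (norm_half_pow_lt h)
    (fun φ => ?_) ?_ φ
  · have h1 := hL.diag 1 (1 / 2) one_ne_zero hr.ne' φ
    rw [signedPow_one, signedPow_one, one_mul, one_mul, div_one, signedPow_of_pos _ _ hr,
      signedPow_of_pos _ _ hr] at h1
    have hne : ((1 / 2 : ℝ) : ℂ) ^ (1 - lam 2) ≠ 0 := by simp [Complex.cpow_eq_zero_iff]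
    refine mul_left_cancel₀ hne (h1.trans ?_)
    rw [← mul_assoc, ← Complex.cpow_add _ _ hr']
    congr 2
    ring
  · have := dil_monomial 1 (1 / 2) (1 / 2) 0 b c
    simp only [pow_zero, one_mul] at this
    rw [this, pow_add]

/-- Here `diag (1/2, 1/2)` contracts `x` and `z` and fixes `y`, with exponent `λ₂ + λ₃ - ν₁ - ν₂ -
1`. -/
theorem IsEquivariant.map_mul_eq_zero_of_lt' (hL : IsEquivariant ξ lam η ν L) {a c : ℕ}
    (h : (lam 1 + lam 2 - ν 0 - ν 1 - 1).re < ((a + c : ℕ) : ℝ)) (φ : Smooth) :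
    L (X ^ a * Z ^ c * φ) = 0 := by
  have hr : (0 : ℝ) < 1 / 2 := by norm_num
  have hr' : ((1 / 2 : ℝ) : ℂ) ≠ 0 := by exact_mod_cast hr.ne'
  refine map_mul_eq_zero_of_contracting hL.isLocal (α := 1 / 2) (β := 1) (γ := 1 / 2)
    (by rw [abs_of_pos hr]; norm_num) (by simp) (by rw [abs_of_pos hr]; norm_num)
    (norm_half_pow_lt h) (fun φ => ?_) ?_ φ
  · have h1 := hL.diag (1 / 2) (1 / 2) hr.ne' hr.ne' φ
    rw [div_self hr.ne', signedPow_of_pos _ _ hr, signedPow_of_pos _ _ hr,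
      signedPow_of_pos _ _ hr, signedPow_of_pos _ _ hr, ← Complex.cpow_add _ _ hr',
      ← Complex.cpow_add _ _ hr'] at h1
    have hne : ((1 / 2 : ℝ) : ℂ) ^ (-lam 1 + (1 - lam 2)) ≠ 0 := by
      simp [Complex.cpow_eq_zero_iff]
    refine mul_left_cancel₀ hne (h1.trans ?_)
    rw [← mul_assoc, ← Complex.cpow_add _ _ hr']
    congr 2
    ring
  · have := dil_monomial (1 / 2) 1 (1 / 2) a 0 c
    simp only [pow_zero, mul_one] at this
    rw [this, pow_add]

theorem neg_one_pow_val_eq {m n : ZMod 2} {k : ℕ}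
    (h : (-1 : ℂ) ^ m.val * (-1) ^ k = (-1) ^ n.val) : n = m + k := by
  have hk : (-1 : ℂ) ^ k = (-1) ^ ((k : ZMod 2)).val := by
    rw [ZMod.val_natCast]
    exact neg_one_pow_eq_pow_mod_two k
  rw [hk] at h
  generalize (k : ZMod 2) = l at *
  have h1 : (ZMod.val (1 : ZMod 2)) = 1 := rfl
  have h2 : ∀ a : ZMod 2, a = 0 ∨ a = 1 := by decide
  rcases h2 m with rfl | rfl <;> rcases h2 n with rfl | rfl <;> rcases h2 l with rfl | rfl <;>
    first | decide | (exfalso; norm_num [h1] at h)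

/-- Monomials are torus eigenvectors, so a nonzero value equates two characters of the diagonal
group. Positive entries compare exponents and entries `-1` compare parities. -/
theorem IsEquivariant.weight (hL : IsEquivariant ξ lam η ν L) {i j k : ℕ}
    (h : L (X ^ i * Y ^ j * Z ^ k) ≠ 0) :
    lam 2 - ν 1 - 1 / 2 = ((j + k : ℕ) : ℂ) ∧
      lam 1 + lam 2 - ν 0 - ν 1 - 1 = ((i + k : ℕ) : ℂ) ∧
      η 0 = ξ 1 + ((j + k + (i + k) : ℕ) : ZMod 2) ∧ η 1 = ξ 2 + ((j + k : ℕ) : ZMod 2) := by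
  have key : ∀ a b : ℝ, a ≠ 0 → b ≠ 0 →
      signedPow (ξ 1) (-lam 1) a * signedPow (ξ 2) (1 - lam 2) b *
        ((a : ℂ) ^ i * ((b / a : ℝ) : ℂ) ^ j * (b : ℂ) ^ k) =
      signedPow (η 0) (-ν 0 - 1 / 2) a * signedPow (η 1) (1 / 2 - ν 1) b := by
    intro a b ha hb
    have h1 := hL.diag a b ha hb (X ^ i * Y ^ j * Z ^ k)
    rw [dil_monomial, map_smul, smul_eq_mul, ← mul_assoc] at h1
    exact mul_right_cancel₀ h h1
  have w1 : -lam 1 + i = -ν 0 - 1 / 2 + j := by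
    refine cpow_exponent_injective fun a ha => ?_
    have ha' : (a : ℂ) ≠ 0 := by exact_mod_cast ha.ne'
    have h1 := key a 1 ha.ne' one_ne_zero
    rw [signedPow_one, signedPow_one, signedPow_of_pos _ _ ha, signedPow_of_pos _ _ ha] at h1
    push_cast at h1
    rw [Complex.cpow_add _ _ ha', Complex.cpow_add _ _ ha', Complex.cpow_natCast,
      Complex.cpow_natCast]
    rw [one_pow, mul_one, mul_one, mul_one, one_div, inv_pow] at h1
    have hj : (a : ℂ) ^ j ≠ 0 := pow_ne_zero _ ha'
    rw [← h1]
    field_simp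
  have w2 : 1 - lam 2 + ((j + k : ℕ) : ℂ) = 1 / 2 - ν 1 := by
    refine cpow_exponent_injective fun a ha => ?_
    have ha' : (a : ℂ) ≠ 0 := by exact_mod_cast ha.ne'
    have h1 := key 1 a one_ne_zero ha.ne'
    rw [signedPow_one, signedPow_one, signedPow_of_pos _ _ ha, signedPow_of_pos _ _ ha] at h1
    rw [Complex.cpow_add _ _ ha', Complex.cpow_natCast, ← one_mul ((a : ℂ) ^ (1 / 2 - ν 1)), ← h1]
    push_cast
    simp [pow_add]
  refine ⟨by linear_combination -w2, ?_, ?_, ?_⟩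
  · push_cast at w2 ⊢
    linear_combination -w2 - w1
  · have h1 := key (-1) 1 (by norm_num) one_ne_zero
    rw [signedPow_one, signedPow_one, signedPow_neg _ _ one_pos, signedPow_neg _ _ one_pos] at h1
    have h2 := neg_one_pow_val_eq (m := ξ 1) (n := η 0) (k := i + j) (by
      simpa [pow_add, mul_assoc, inv_pow, div_eq_mul_inv] using h1)
    rw [h2]
    -- The torus gives the parity of `i + j`, which differs from `j + k + (i + k)` by `2 k`.
    have : (2 : ZMod 2) = 0 := rfl
    push_cast
    linear_combination (-(k : ZMod 2)) * this
  · have h1 := key 1 (-1) one_ne_zero (by norm_num)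
    rw [signedPow_one, signedPow_one, signedPow_neg _ _ one_pos, signedPow_neg _ _ one_pos] at h1
    exact neg_one_pow_val_eq (by simpa [pow_add, mul_assoc] using h1)

theorem IsEquivariant.eq_zero_of_monomials (hL : IsEquivariant ξ lam η ν L)
    (h : ∀ i j k, L (X ^ i * Y ^ j * Z ^ k) = 0) : L = 0 := by
  obtain ⟨m₁, hm₁⟩ := exists_nat_gt (lam 2 - ν 1 - 1 / 2).re
  obtain ⟨m₂, hm₂⟩ := exists_nat_gt (lam 1 + lam 2 - ν 0 - ν 1 - 1).re
  -- Total degree at least `m₁ + m₂` forces `b + c ≥ m₁` or `a + c ≥ m₂`, so one of the two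
  -- contractions applies.
  refine map_eq_zero_of_monomials (N := m₁ + m₂) (fun a b c φ hN => ?_) h
  rcases le_or_gt m₁ (b + c) with hb | hb
  · rw [show X ^ a * Y ^ b * Z ^ c * φ = Y ^ b * Z ^ c * (X ^ a * φ) by ring]
    exact hL.map_mul_eq_zero_of_lt (hm₁.trans_le (by exact_mod_cast hb)) _
  · rw [show X ^ a * Y ^ b * Z ^ c * φ = X ^ a * Z ^ c * (Y ^ b * φ) by ring]
    exact hL.map_mul_eq_zero_of_lt' (hm₂.trans_le (by exact_mod_cast (by omega : m₂ ≤ a + c))) _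

/-- A globally smooth representative of the germ of `(1 + y)^μ`. The cutoff `dil 4 4 4 cut` vanishes
for norm at least `1/2`, well inside the region `1 + y > 0`. -/
theorem exists_one_add_pow (μ : ℂ) :
    ∃ W : Smooth, (W.1 =ᶠ[𝓝 0] fun v => Complex.exp (μ * (Real.log (1 + v.2.1) : ℂ))) ∧
      W.1 0 = 1 ∧ (D (0, 1, 0) W).1 0 = μ := by
  let w : ℝ × ℝ × ℝ → ℂ := fun v => Complex.exp (μ * (Real.log (1 + v.2.1) : ℂ))
  have hw : ContDiff ℝ ∞ (fun v => (dil 4 4 4 cut).1 v * w v) := by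
    rw [contDiff_iff_contDiffAt]
    intro v
    rcases lt_or_ge ‖v‖ 1 with hv | hv
    · have h1 : 1 + v.2.1 ≠ 0 := by
        have : |v.2.1| < 1 := ((norm_fst_le v.2).trans (norm_snd_le v)).trans_lt hv
        have := (abs_lt.1 this).1
        linarith
      refine (contDiff (dil 4 4 4 cut)).contDiffAt.mul (ContDiffAt.cexp (contDiffAt_const.mul ?_))
      exact Complex.ofRealCLM.contDiff.contDiffAt.comp v
        (ContDiffAt.log (by fun_prop) h1)
    · refine (contDiffAt_const (c := (0 : ℂ))).congr_of_eventuallyEq ?_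
      filter_upwards [continuous_norm.continuousAt.eventually
        (lt_mem_nhds (by linarith : 1 / 2 < ‖v‖))] with u hu
      have h0 : (dil 4 4 4 cut).1 u = 0 := by
        refine cut_eq_zero ?_
        change 2 ≤ ‖(4 : ℝ) • u‖
        rw [norm_smul]
        norm_num
        linarith
      rw [h0, zero_mul]
  have hev : (fun v => (dil 4 4 4 cut).1 v * w v) =ᶠ[𝓝 0] w := by
    have h := (diagCLM 4 4 4).continuous.tendsto 0
    rw [map_zero] at h
    filter_upwards [h.eventually cut_eventuallyEq] with v hv
    change cut.1 (diagCLM 4 4 4 v) * w v = w v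
    rw [hv]
    simp
  let W : Smooth := ⟨_, hw⟩
  refine ⟨W, hev, ?_, ?_⟩
  · rw [show W.1 0 = w 0 from hev.self_of_nhds]
    simp [w]
  · have h1 : HasDerivAt (fun t : ℝ => W.1 (t • (0, 1, 0))) ((D (0, 1, 0) W).1 0) 0 := by
      have e := (differentiable W ((0 : ℝ) • (0, 1, 0))).hasFDerivAt.comp_hasDerivAt (0 : ℝ)
        ((hasDerivAt_id (0 : ℝ)).smul_const ((0, 1, 0) : ℝ × ℝ × ℝ))
      rw [D_apply]
      simpa [Function.comp_def] using e
    have h2 : HasDerivAt (fun t : ℝ => Complex.exp (μ * (Real.log (1 + t) : ℂ))) μ 0 := by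
      have h3 : HasDerivAt (fun t : ℝ => Real.log (1 + t)) 1 0 := by
        simpa using ((hasDerivAt_id (0 : ℝ)).const_add 1).log (by simp)
      simpa using ((h3.ofReal_comp).const_mul μ).cexp
    refine h1.unique (h2.congr_of_eventuallyEq ?_)
    have hc : Filter.Tendsto (fun t : ℝ => t • ((0, 1, 0) : ℝ × ℝ × ℝ)) (𝓝 0) (𝓝 0) := by
      have : Continuous (fun t : ℝ => t • ((0, 1, 0) : ℝ × ℝ × ℝ)) := by fun_prop
      simpa using this.tendsto 0
    filter_upwards [hc.eventually hev] with t ht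
    refine ht.trans ?_
    simp [w]

/-! ### The recursion on monomials of critical weight -/

section Recursion

variable {n₁ n₂ : ℕ} (hL : IsEquivariant ξ lam η ν L) (h₁ : lam 2 - ν 1 - 1 / 2 = (n₁ : ℂ))
  (h₂ : lam 1 + lam 2 - ν 0 - ν 1 - 1 = (n₂ : ℂ))
include hL

include h₁ in
theorem IsEquivariant.vanish_YZ {a b c : ℕ} (h : n₁ < b + c) (φ : Smooth) :
    L (X ^ a * Y ^ b * Z ^ c * φ) = 0 := by
  rw [show X ^ a * Y ^ b * Z ^ c * φ = Y ^ b * Z ^ c * (X ^ a * φ) by ring]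
  refine hL.map_mul_eq_zero_of_lt ?_ _
  rw [h₁, Complex.natCast_re]
  exact_mod_cast h

include h₂ in
theorem IsEquivariant.vanish_XZ {a b c : ℕ} (h : n₂ < a + c) (φ : Smooth) :
    L (X ^ a * Y ^ b * Z ^ c * φ) = 0 := by
  rw [show X ^ a * Y ^ b * Z ^ c * φ = X ^ a * Z ^ c * (Y ^ b * φ) by ring]
  refine hL.map_mul_eq_zero_of_lt' ?_ _
  rw [h₂, Complex.natCast_re]
  exact_mod_cast h

include h₁ h₂

/-- At the critical weight each of the three Hadamard remainders has excess weight and is killed, so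
only `φ 0` survives. -/
theorem IsEquivariant.map_monomial_mul {a b c : ℕ} (hac : a + c = n₂) (hbc : b + c = n₁)
    (φ : Smooth) :
    L (X ^ a * Y ^ b * Z ^ c * φ) = φ.1 0 * L (X ^ a * Y ^ b * Z ^ c) := by
  obtain ⟨φ₁, φ₂, φ₃, h, -⟩ := exists_hadamard_mul (X ^ a * Y ^ b * Z ^ c) φ
  have e1 := hL.vanish_XZ h₂ (a := a + 1) (b := b) (c := c) (by omega) φ₁
  have e2 := hL.vanish_YZ h₁ (a := a) (b := b + 1) (c := c) (by omega) φ₂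
  have e3 := hL.vanish_XZ h₂ (a := a) (b := b) (c := c + 1) (by omega) φ₃
  rw [h, map_add, map_add, map_add, map_smul, smul_eq_mul,
    show X ^ a * Y ^ b * Z ^ c * X * φ₁ = X ^ (a + 1) * Y ^ b * Z ^ c * φ₁ by ring, e1,
    show X ^ a * Y ^ b * Z ^ c * Y * φ₂ = X ^ a * Y ^ (b + 1) * Z ^ c * φ₂ by ring, e2,
    show X ^ a * Y ^ b * Z ^ c * Z * φ₃ = X ^ a * Y ^ b * Z ^ (c + 1) * φ₃ by ring, e3]
  ring

theorem IsEquivariant.map_monomial_eq_zero {a b c : ℕ} (h : ¬ (b + c = n₁ ∧ a + c = n₂)) :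
    L (X ^ a * Y ^ b * Z ^ c) = 0 := by
  by_contra hne
  obtain ⟨w1, w2, -⟩ := hL.weight hne
  exact h ⟨by exact_mod_cast (w1.symm.trans h₁), by exact_mod_cast (w2.symm.trans h₂)⟩

/-- One power of `Y` below the critical weight, the constant term has the wrong weight and the `X`
and `Z` remainders have excess weight. Only the first-order term in `y` remains. -/
theorem IsEquivariant.map_monomial_mul' {a b c : ℕ} (hac : a + c = n₂) (hbc : b + c + 1 = n₁)
    (φ : Smooth) :
    L (X ^ a * Y ^ b * Z ^ c * φ) =
      (D (0, 1, 0) φ).1 0 * L (X ^ a * Y ^ (b + 1) * Z ^ c) := by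
  obtain ⟨φ₁, φ₂, φ₃, h, hφ₂⟩ := exists_hadamard_mul (X ^ a * Y ^ b * Z ^ c) φ
  have e1 := hL.vanish_XZ h₂ (a := a + 1) (b := b) (c := c) (by omega) φ₁
  have e2 := hL.map_monomial_mul h₁ h₂ (a := a) (b := b + 1) (c := c) hac (by omega) φ₂
  have e3 := hL.vanish_XZ h₂ (a := a) (b := b) (c := c + 1) (by omega) φ₃
  have e0 := hL.map_monomial_eq_zero h₁ h₂ (a := a) (b := b) (c := c) (by omega)
  rw [h, map_add, map_add, map_add, map_smul, e0, smul_zero,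
    show X ^ a * Y ^ b * Z ^ c * X * φ₁ = X ^ (a + 1) * Y ^ b * Z ^ c * φ₁ by ring, e1,
    show X ^ a * Y ^ b * Z ^ c * Y * φ₂ = X ^ a * Y ^ (b + 1) * Z ^ c * φ₂ by ring, e2,
    show X ^ a * Y ^ b * Z ^ c * Z * φ₃ = X ^ a * Y ^ b * Z ^ (c + 1) * φ₃ by ring, e3, hφ₂]
  ring

/-- Invariance under the unipotent element with `s = 1` is tested on `X^i Y^j Z^k`, which lies one
power of `Y` below the critical weight. The transformed germ is `(X + Z)^i Y^j Z^k (1 + Y)^(λ₃ - λ₂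
- 1 - j)`, and only two terms of its expansion have critical weight. -/
theorem IsEquivariant.recursion {i j k : ℕ} (hi : i + k = n₂) (hj : j + k + 1 = n₁) :
    (lam 2 - lam 1 - 1 - j) * L (X ^ i * Y ^ (j + 1) * Z ^ k) +
      i * L (X ^ (i - 1) * Y ^ j * Z ^ (k + 1)) = 0 := by
  obtain ⟨W, hW, hW0, hW1⟩ := exists_one_add_pow (lam 2 - lam 1 - 1 - j)
  obtain ⟨Q, hQ⟩ := Polynomial.powAddExpansion X Z i
  have hLM := hL.map_monomial_eq_zero h₁ h₂ (a := i) (b := j) (c := k) (by omega)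
  have hψ := hL.unipotent (X ^ i * Y ^ j * Z ^ k) ((X + Z) ^ i * Y ^ j * Z ^ k * W) (by
    have hpos : ∀ᶠ v : ℝ × ℝ × ℝ in 𝓝 0, 0 < 1 + v.2.1 :=
      ContinuousAt.eventually_lt (by fun_prop) (by fun_prop) (by simp)
    filter_upwards [hW, hpos] with v hv hp
    have e : Complex.exp ((lam 2 - lam 1 - 1 - j) * (Real.log (1 + v.2.1) : ℂ)) *
        ((1 + v.2.1 : ℝ) : ℂ) ^ j =
        Complex.exp ((lam 2 - lam 1 - 1) * (Real.log (1 + v.2.1) : ℂ)) := by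
      conv_lhs => rw [← Real.exp_log hp, Complex.ofReal_exp, ← Complex.exp_nat_mul,
        ← Complex.exp_add]
      rw [Real.exp_log hp]
      congr 1
      ring
    have hne : ((1 + v.2.1 : ℝ) : ℂ) ≠ 0 := by exact_mod_cast hp.ne'
    change ((v.1 : ℂ) + v.2.2) ^ i * (v.2.1 : ℂ) ^ j * (v.2.2 : ℂ) ^ k * W.1 v =
      _ * (((v.1 + v.2.2 : ℝ) : ℂ) ^ i * ((v.2.1 / (1 + v.2.1) : ℝ) : ℂ) ^ j * (v.2.2 : ℂ) ^ k)
    rw [hv, ← e, Complex.ofReal_div, div_pow, Complex.ofReal_add v.1]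
    field_simp)
  -- The binomial remainder carries `Z^2`, so it has weight `j + k + 2 > n₁` in `(y, z)` and is
  -- killed by `L`.
  have hexp : (X + Z) ^ i * Y ^ j * Z ^ k * W = X ^ i * Y ^ j * Z ^ k * W +
      (i : ℂ) • (X ^ (i - 1) * Y ^ j * Z ^ (k + 1) * W) +
      X ^ 0 * Y ^ j * Z ^ (k + 2) * (Q * W) := by
    rw [hQ, Nat.cast_smul_eq_nsmul, nsmul_eq_mul]
    ring
  rw [hexp, map_add, map_add, map_smul, hL.map_monomial_mul' h₁ h₂ hi hj, hW1,
    hL.vanish_YZ h₁ (a := 0) (b := j) (c := k + 2) (by omega), hLM, add_zero, smul_eq_mul] at hψ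
  rcases Nat.eq_zero_or_pos i with rfl | hpos
  · simpa using hψ
  · rwa [hL.map_monomial_mul h₁ h₂ (by omega) (by omega), hW0, one_mul] at hψ

/-- The recursion passes from `Z^k` to `Z^(k+1)` with coefficient `n₂ - k`, which is nonzero as long
as the next monomial exists. -/
theorem IsEquivariant.eq_zero_of_leading (h : L (X ^ n₂ * Y ^ n₁) = 0) : L = 0 := by
  have key : ∀ k, k ≤ n₁ → k ≤ n₂ → L (X ^ (n₂ - k) * Y ^ (n₁ - k) * Z ^ k) = 0 := by
    intro k
    induction k with
    | zero => intro _ _; simpa using h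
    | succ k ih =>
      intro hk1 hk2
      have hr := hL.recursion h₁ h₂ (i := n₂ - k) (j := n₁ - (k + 1)) (k := k) (by omega)
        (by omega)
      rw [show n₁ - (k + 1) + 1 = n₁ - k by omega, ih (by omega) (by omega), mul_zero, zero_add,
        show n₂ - k - 1 = n₂ - (k + 1) by omega] at hr
      refine (mul_eq_zero.1 hr).resolve_left ?_
      exact Nat.cast_ne_zero.2 (by omega)
  refine hL.eq_zero_of_monomials fun i j k => ?_
  by_cases hw : j + k = n₁ ∧ i + k = n₂
  · have := key k (by omega) (by omega)
    rwa [show n₂ - k = i by omega, show n₁ - k = j by omega] at this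
  · exact hL.map_monomial_eq_zero h₁ h₂ hw

/-- Since `n₂ < n₁`, the recursion is also available at `k = n₂`, where `i = 0` and its second term
disappears. Solving backwards from there down to `k = 0` divides by `λ₃ - λ₂ - n₁ + k`. -/
theorem IsEquivariant.eq_zero_of_lt (hlt : n₂ < n₁)
    (hk : ∀ k : ℕ, k ≤ n₂ → lam 2 - lam 1 - (n₁ : ℂ) + k ≠ 0) : L = 0 := by
  have step : ∀ k, k ≤ n₂ →
      L (X ^ (n₂ - k - 1) * Y ^ (n₁ - (k + 1)) * Z ^ (k + 1)) = 0 ∨ k = n₂ →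
      L (X ^ (n₂ - k) * Y ^ (n₁ - k) * Z ^ k) = 0 := by
    intro k hkn h
    have hr := hL.recursion h₁ h₂ (i := n₂ - k) (j := n₁ - (k + 1)) (k := k) (by omega) (by omega)
    have h0 : ((n₂ - k : ℕ) : ℂ) * L (X ^ (n₂ - k - 1) * Y ^ (n₁ - (k + 1)) * Z ^ (k + 1)) = 0 := by
      rcases h with h | rfl
      · rw [h, mul_zero]
      · simp
    rw [h0, add_zero, show n₁ - (k + 1) + 1 = n₁ - k by omega] at hr
    refine (mul_eq_zero.1 hr).resolve_left ?_
    have := hk k hkn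
    rw [Nat.cast_sub (by omega)]
    push_cast
    intro h
    exact this (by linear_combination h)
  have all : ∀ d, d ≤ n₂ → L (X ^ (n₂ - (n₂ - d)) * Y ^ (n₁ - (n₂ - d)) * Z ^ (n₂ - d)) = 0 := by
    intro d
    induction d with
    | zero => exact fun _ => step n₂ le_rfl (Or.inr rfl)
    | succ d ih =>
      intro hd
      refine step (n₂ - (d + 1)) (by omega) (Or.inl ?_)
      have := ih (by omega)
      rwa [show n₂ - d = n₂ - (d + 1) + 1 by omega, Nat.sub_add_eq n₂] at this
  refine hL.eq_zero_of_leading h₁ h₂ ?_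
  simpa using all n₂ le_rfl

end Recursion

theorem IsEquivariant.exists_condition (hL : IsEquivariant ξ lam η ν L) (hne : L ≠ 0) :
    ∃ n₁ n₂ : ℕ, DSBO0Condition ξ lam η ν n₁ n₂ := by
  have : ∃ i j k, L (X ^ i * Y ^ j * Z ^ k) ≠ 0 := by
    by_contra! h
    exact hne (hL.eq_zero_of_monomials h)
  obtain ⟨i, j, k, h⟩ := this
  obtain ⟨w1, w2, w3, w4⟩ := hL.weight h
  refine ⟨j + k, i + k, w1, w2, ?_, w3, w4⟩
  by_contra hc
  rw [not_or, not_le] at hc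
  exact hne (hL.eq_zero_of_lt w1 w2 hc.1 fun k hk h0 => hc.2 ⟨k, hk, h0⟩)

end Smooth

namespace Smooth

/-! ### Derivatives of the Dirac distribution at the origin -/

theorem D_eventuallyEq (w : ℝ × ℝ × ℝ) {φ ψ : Smooth} (h : φ.1 =ᶠ[𝓝 0] ψ.1) :
    (D w φ).1 =ᶠ[𝓝 0] (D w ψ).1 :=
  h.fderiv.mono fun _ hv => congrArg (fun l : ℝ × ℝ × ℝ →L[ℝ] ℂ => l w) hv

theorem D_pow_eventuallyEq (w : ℝ × ℝ × ℝ) (n : ℕ) {φ ψ : Smooth} (h : φ.1 =ᶠ[𝓝 0] ψ.1) :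
    ((D w ^ n) φ).1 =ᶠ[𝓝 0] ((D w ^ n) ψ).1 := by
  induction n with
  | zero => exact h
  | succ n ih =>
    rw [pow_succ', Module.End.mul_apply, Module.End.mul_apply]
    exact D_eventuallyEq w ih

theorem D_pow_mul_of_eq_zero {w : ℝ × ℝ × ℝ} {x : Smooth} (hx : D w x = 0) (n : ℕ)
    (φ : Smooth) : (D w ^ n) (x * φ) = x * (D w ^ n) φ := by
  induction n with
  | zero => rfl
  | succ n ih => simp only [pow_succ', Module.End.mul_apply, ih, D_mul, hx, zero_mul, zero_add]

theorem D_pow_mul_of_eq_one {w : ℝ × ℝ × ℝ} {x : Smooth} (hx : D w x = 1) (n : ℕ)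
    (φ : Smooth) : (D w ^ n) (x * φ) = x * (D w ^ n) φ + (n : ℂ) • (D w ^ (n - 1)) φ := by
  induction n with
  | zero => simp
  | succ n ih =>
    rw [pow_succ', Module.End.mul_apply, ih, map_add, map_smul, D_mul, hx, one_mul,
      Nat.add_sub_cancel, Module.End.mul_apply]
    rcases Nat.eq_zero_or_pos n with rfl | hn
    · simp [add_comm]
    · have h1 : D w ((D w ^ (n - 1)) φ) = (D w ^ n) φ := by
        rw [← Module.End.mul_apply, ← pow_succ', Nat.sub_add_cancel hn]
      rw [h1]
      push_cast
      module

/-- The mixed partial derivative `∂_x^a ∂_y^b ∂_z^c`. -/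
def partials (a b c : ℕ) : Module.End ℂ Smooth :=
  D (1, 0, 0) ^ a * D (0, 1, 0) ^ b * D (0, 0, 1) ^ c

/-- The distribution `δ^(a)(x) δ^(b)(y) δ^(c)(z)`. -/
def delta (a b c : ℕ) : Smooth →ₗ[ℂ] ℂ where
  toFun φ := (-1) ^ (a + b + c) * (partials a b c φ).1 0
  map_add' φ ψ := by
    rw [map_add, Subalgebra.coe_add, Pi.add_apply, mul_add]
  map_smul' s φ := by
    rw [map_smul]
    change _ * (s * (partials a b c φ).1 0) = s * _
    ring

theorem delta_apply (a b c : ℕ) (φ : Smooth) :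
    delta a b c φ = (-1) ^ (a + b + c) * (partials a b c φ).1 0 := rfl

theorem isLocal_delta (a b c : ℕ) : IsLocal (delta a b c) := by
  intro φ ψ h
  simp only [delta_apply, partials, Module.End.mul_apply]
  rw [(D_pow_eventuallyEq _ a (D_pow_eventuallyEq _ b (D_pow_eventuallyEq _ c h))).self_of_nhds]

theorem iteratedDeriv_comp_line (φ : Smooth) (w : ℝ × ℝ × ℝ) (γ : ℝ → ℝ × ℝ × ℝ)
    (hγ : ∀ t, HasDerivAt γ w t) (n : ℕ) :
    iteratedDeriv n (fun t => φ.1 (γ t)) = fun t => ((D w ^ n) φ).1 (γ t) := by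
  induction n with
  | zero => rfl
  | succ n ih =>
    rw [iteratedDeriv_succ, ih]
    funext t
    rw [pow_succ', Module.End.mul_apply]
    exact ((differentiable _ _).hasFDerivAt.comp_hasDerivAt t (hγ t)).deriv

/-- Iterated derivatives along coordinate lines are powers of the directional derivatives `D`, so
the pairing in the statement becomes algebra in the endomorphisms of `Smooth`. -/
theorem deltaPairing_eq (a b c : ℕ) (φ : Smooth) :
    deltaPairing a b c (fun x y z => φ.1 (x, y, z)) = delta a b c φ := by
  have h1 : ∀ x t : ℝ, HasDerivAt (fun x : ℝ => (x, (0 : ℝ), (0 : ℝ))) (1, 0, 0) t := fun x t =>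
    (hasDerivAt_id t).prodMk ((hasDerivAt_const t _).prodMk (hasDerivAt_const t _))
  have h2 : ∀ x t : ℝ, HasDerivAt (fun y : ℝ => (x, y, (0 : ℝ))) (0, 1, 0) t := fun x t =>
    (hasDerivAt_const t _).prodMk ((hasDerivAt_id t).prodMk (hasDerivAt_const t _))
  have h3 : ∀ x y t : ℝ, HasDerivAt (fun z : ℝ => (x, y, z)) (0, 0, 1) t := fun x y t =>
    (hasDerivAt_const t _).prodMk ((hasDerivAt_const t _).prodMk (hasDerivAt_id t))
  rw [deltaPairing, delta_apply]
  congr 1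
  simp_rw [iteratedDeriv_comp_line φ _ _ (h3 _ _) c,
    iteratedDeriv_comp_line ((D (0, 0, 1) ^ c) φ) _ _ (h2 _) b,
    iteratedDeriv_comp_line ((D (0, 1, 0) ^ b) ((D (0, 0, 1) ^ c) φ)) _ _ (h1 0) a]
  rfl

/-- The transpose of `[∂_x, X] = 1`, evaluated at the origin where `X` vanishes. For `a = 0` the
truncated index `a - 1` is harmless because its coefficient is zero. -/
theorem delta_X_mul (a b c : ℕ) (φ : Smooth) :
    delta a b c (X * φ) = -(a : ℂ) * delta (a - 1) b c φ := by
  simp only [delta_apply, partials, Module.End.mul_apply]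
  rw [D_pow_mul_of_eq_zero (by rw [D_X]; simp), D_pow_mul_of_eq_zero (by rw [D_X]; simp),
    D_pow_mul_of_eq_one (by rw [D_X]; simp)]
  rcases Nat.eq_zero_or_pos a with rfl | ha
  · simp [X]
  · obtain ⟨a, rfl⟩ := Nat.exists_eq_add_of_lt ha
    simp [X, pow_add]
    ring

theorem delta_Y_mul (a b c : ℕ) (φ : Smooth) :
    delta a b c (Y * φ) = -(b : ℂ) * delta a (b - 1) c φ := by
  simp only [delta_apply, partials, Module.End.mul_apply]
  rw [D_pow_mul_of_eq_zero (by rw [D_Y]; simp), D_pow_mul_of_eq_one (by rw [D_Y]; simp),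
    map_add, map_smul, D_pow_mul_of_eq_zero (by rw [D_Y]; simp)]
  rcases Nat.eq_zero_or_pos b with rfl | hb
  · simp [Y]
  · obtain ⟨b, rfl⟩ := Nat.exists_eq_add_of_lt hb
    simp [Y, pow_add]
    ring

theorem delta_Z_mul (a b c : ℕ) (φ : Smooth) :
    delta a b c (Z * φ) = -(c : ℂ) * delta a b (c - 1) φ := by
  simp only [delta_apply, partials, Module.End.mul_apply]
  rw [D_pow_mul_of_eq_one (by rw [D_Z]; simp), map_add, map_smul, map_add, map_smul,
    D_pow_mul_of_eq_zero (by rw [D_Z]; simp), D_pow_mul_of_eq_zero (by rw [D_Z]; simp)]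
  rcases Nat.eq_zero_or_pos c with rfl | hc
  · simp [Z]
  · obtain ⟨c, rfl⟩ := Nat.exists_eq_add_of_lt hc
    simp [Z, pow_add]
    ring

theorem commute_D (w w' : ℝ × ℝ × ℝ) : Commute (D w : Module.End ℂ Smooth) (D w') :=
  LinearMap.ext fun φ => D_comm w w' φ

theorem delta_D_X (a b c : ℕ) (φ : Smooth) :
    delta a b c (D (1, 0, 0) φ) = -delta (a + 1) b c φ := by
  have h : partials a b c * D (1, 0, 0) = partials (a + 1) b c := by
    rw [partials, partials, mul_assoc, ((commute_D (0, 0, 1) (1, 0, 0)).pow_left c).eq,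
      ← mul_assoc, mul_assoc (D (1, 0, 0) ^ a), ((commute_D (0, 1, 0) (1, 0, 0)).pow_left b).eq,
      ← mul_assoc, pow_succ]
  rw [delta_apply, ← Module.End.mul_apply, h, delta_apply]
  ring

theorem delta_D_Y (a b c : ℕ) (φ : Smooth) :
    delta a b c (D (0, 1, 0) φ) = -delta a (b + 1) c φ := by
  have h : partials a b c * D (0, 1, 0) = partials a (b + 1) c := by
    rw [partials, partials, mul_assoc, ((commute_D (0, 0, 1) (0, 1, 0)).pow_left c).eq,
      ← mul_assoc, mul_assoc (D (1, 0, 0) ^ a), pow_succ]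
  rw [delta_apply, ← Module.End.mul_apply, h, delta_apply]
  ring

theorem D_dil (α β γ : ℝ) (w : ℝ × ℝ × ℝ) (s : ℝ) (hw : diagCLM α β γ w = s • w) (n : ℕ)
    (φ : Smooth) : (D w ^ n) (dil α β γ φ) = (s : ℂ) ^ n • dil α β γ ((D w ^ n) φ) := by
  induction n with
  | zero => simp
  | succ n ih =>
    rw [pow_succ', Module.End.mul_apply, ih, map_smul, Module.End.mul_apply, pow_succ, mul_smul]
    congr 1
    ext v
    change fderiv ℝ (((D w ^ n) φ).1 ∘ diagCLM α β γ) v w =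
      s * fderiv ℝ ((D w ^ n) φ).1 (diagCLM α β γ v) w
    rw [fderiv_comp v (differentiable _ _) (ContinuousLinearMap.differentiableAt _),
      ContinuousLinearMap.fderiv, ContinuousLinearMap.comp_apply, hw, map_smul, Complex.real_smul]

theorem delta_dil (α β γ : ℝ) (a b c : ℕ) (φ : Smooth) :
    delta a b c (dil α β γ φ) = (α : ℂ) ^ a * (β : ℂ) ^ b * (γ : ℂ) ^ c * delta a b c φ := by
  simp only [delta_apply, partials, Module.End.mul_apply]
  rw [D_dil α β γ (0, 0, 1) γ (by simp [diagCLM_apply]), map_smul,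
    D_dil α β γ (0, 1, 0) β (by simp [diagCLM_apply]), map_smul, map_smul,
    D_dil α β γ (1, 0, 0) α (by simp [diagCLM_apply])]
  have h0 : ∀ ψ : Smooth, (dil α β γ ψ).1 0 = ψ.1 0 := fun ψ => by
    simp [dil_apply]
    rfl
  change _ * ((γ : ℂ) ^ c * ((β : ℂ) ^ b * ((α : ℂ) ^ a * (dil α β γ _).1 0))) = _
  rw [h0]
  ring

theorem delta_X_pow_mul (n a b c : ℕ) (φ : Smooth) :
    delta a b c (X ^ n * φ) = (-1) ^ n * (a.descFactorial n : ℂ) * delta (a - n) b c φ := by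
  induction n generalizing φ with
  | zero => simp
  | succ n ih =>
    rw [pow_succ, mul_assoc, ih, delta_X_mul, Nat.descFactorial_succ, pow_succ, Nat.sub_sub]
    push_cast
    ring

theorem delta_Y_pow_mul (n a b c : ℕ) (φ : Smooth) :
    delta a b c (Y ^ n * φ) = (-1) ^ n * (b.descFactorial n : ℂ) * delta a (b - n) c φ := by
  induction n generalizing φ with
  | zero => simp
  | succ n ih =>
    rw [pow_succ, mul_assoc, ih, delta_Y_mul, Nat.descFactorial_succ, pow_succ, Nat.sub_sub]
    push_cast
    ring

/-! ### The kernel functional -/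

/-- The pairing of a smooth function with the distribution kernel. -/
def kernelFunctional (lam : Fin 3 → ℂ) (n₁ n₂ : ℕ) : Smooth →ₗ[ℂ] ℂ :=
  ∑ j ∈ Finset.range (min n₁ n₂ + 1), kernelCoeff lam n₁ j • delta (n₂ - j) (n₁ - j) j

theorem kernelFunctional_apply (lam : Fin 3 → ℂ) (n₁ n₂ : ℕ) (φ : Smooth) :
    kernelFunctional lam n₁ n₂ φ = ∑ j ∈ Finset.range (min n₁ n₂ + 1),
      kernelCoeff lam n₁ j * delta (n₂ - j) (n₁ - j) j φ := by
  simp [kernelFunctional, LinearMap.sum_apply]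

theorem isLocal_kernelFunctional (lam : Fin 3 → ℂ) (n₁ n₂ : ℕ) :
    IsLocal (kernelFunctional lam n₁ n₂) := by
  intro φ ψ h
  simp only [kernelFunctional_apply, isLocal_delta _ _ _ φ ψ h]

theorem kernelCoeff_zero (lam : Fin 3 → ℂ) (n₁ : ℕ) : kernelCoeff lam n₁ 0 = 1 := by
  simp [kernelCoeff]

/-- The identity that makes consecutive terms cancel in `kernelFunctional_invariant`. -/
theorem kernelCoeff_succ (lam : Fin 3 → ℂ) (n₁ j : ℕ) :
    kernelCoeff lam n₁ (j + 1) * ((j : ℂ) + 1) =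
      kernelCoeff lam n₁ j * ((n₁ : ℂ) - j) * (lam 2 - lam 1 - n₁ + j) := by
  have h : ((j : ℂ) + 1) ≠ 0 := by exact_mod_cast Nat.succ_ne_zero j
  have h' : ((j.factorial : ℕ) : ℂ) ≠ 0 := by exact_mod_cast j.factorial_ne_zero
  simp only [kernelCoeff, ascPochhammer_succ_eval, Nat.factorial_succ, pow_succ]
  push_cast
  field_simp
  ring

/-- For `j > 0` the order `n₂ - j` in `x` is too small to detect `X^n₂`, so only the term `j = 0`,
with coefficient `1`, contributes. -/
theorem kernelFunctional_leading_ne_zero (lam : Fin 3 → ℂ) (n₁ n₂ : ℕ) :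
    kernelFunctional lam n₁ n₂ (X ^ n₂ * Y ^ n₁) ≠ 0 := by
  rw [kernelFunctional_apply, Finset.sum_eq_single 0]
  · rw [kernelCoeff_zero, delta_X_pow_mul, ← mul_one (Y ^ n₁), delta_Y_pow_mul]
    have h1 : delta 0 0 0 1 = 1 := by
      simp [delta_apply, partials]
    simp [h1, Nat.descFactorial_self, Nat.factorial_ne_zero]
  · intro j hj hj0
    rw [delta_X_pow_mul, Nat.descFactorial_of_lt]
    · simp
    · have := Finset.mem_range.1 hj
      omega
  · simp

/-- Every term has the same weight `a^(n₂ - n₁) b^n₁`; multiplying by `a^n₁` avoids a negative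
exponent. -/
theorem kernelFunctional_dil (lam : Fin 3 → ℂ) (n₁ n₂ : ℕ) {a b : ℝ} (ha : a ≠ 0) (φ : Smooth) :
    (a : ℂ) ^ n₁ * kernelFunctional lam n₁ n₂ (dil a (b / a) b φ) =
      (a : ℂ) ^ n₂ * (b : ℂ) ^ n₁ * kernelFunctional lam n₁ n₂ φ := by
  have ha' : (a : ℂ) ≠ 0 := by exact_mod_cast ha
  simp only [kernelFunctional_apply, Finset.mul_sum]
  refine Finset.sum_congr rfl fun j hj => ?_
  have hj := Finset.mem_range.1 hj
  obtain ⟨k, rfl⟩ := Nat.exists_eq_add_of_le (show j ≤ n₁ by omega)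
  obtain ⟨l, rfl⟩ := Nat.exists_eq_add_of_le (show j ≤ n₂ by omega)
  rw [delta_dil, Nat.add_sub_cancel_left, Nat.add_sub_cancel_left]
  push_cast
  rw [div_pow, pow_add, pow_add, pow_add]
  field_simp

theorem ascPochhammer_eval_eq_zero {s : ℂ} {k n : ℕ} (h : s + k = 0) (hkn : k < n) :
    (ascPochhammer ℂ n).eval s = 0 := by
  induction n, hkn using Nat.le_induction with
  | base => rw [ascPochhammer_succ_eval, h, mul_zero]
  | succ n _ ih => rw [ascPochhammer_succ_eval, ih, zero_mul]

/-- The argument is the infinitesimal unipotent action on `φ`. Transposed to the delta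
distributions, each `j` contributes a term at level `j` and one at level `j - 1`. The coefficient
recurrence makes the sum telescope, leaving a single boundary term at `j = min n₁ n₂`. -/
theorem kernelFunctional_invariant {lam : Fin 3 → ℂ} {n₁ n₂ : ℕ}
    (h : n₁ ≤ n₂ ∨ ∃ k₀ : ℕ, k₀ ≤ n₂ ∧ lam 2 - lam 1 - (n₁ : ℂ) + (k₀ : ℂ) = 0) (φ : Smooth) :
    kernelFunctional lam n₁ n₂ ((lam 2 - lam 1 - 1) • (Y * φ) + Z * D (1, 0, 0) φ -
      Y * (Y * D (0, 1, 0) φ)) = 0 := by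
  let e : ℕ → ℂ := fun j => delta (n₂ - j) (n₁ - j - 1) j φ
  let c : ℕ → ℂ := kernelCoeff lam n₁
  let m := min n₁ n₂
  have hterm : ∀ j ∈ Finset.range (m + 1), kernelCoeff lam n₁ j *
      delta (n₂ - j) (n₁ - j) j ((lam 2 - lam 1 - 1) • (Y * φ) + Z * D (1, 0, 0) φ -
        Y * (Y * D (0, 1, 0) φ)) =
      -(c j * ((n₁ : ℂ) - j) * (lam 2 - lam 1 - n₁ + j) * e j) + c j * j * e (j - 1) := by
    intro j hj
    have hj' := Finset.mem_range.1 hj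
    rw [map_sub, map_add, map_smul, delta_Y_mul, delta_Y_mul, delta_Y_mul, delta_Z_mul, delta_D_X,
      delta_D_Y, smul_eq_mul]
    have hb : ((n₁ - j : ℕ) : ℂ) = (n₁ : ℂ) - j := Nat.cast_sub (by omega)
    have t1 : -((n₁ - j : ℕ) : ℂ) * (-((n₁ - j - 1 : ℕ) : ℂ) *
        -delta (n₂ - j) (n₁ - j - 1 - 1 + 1) j φ) =
        -(((n₁ : ℂ) - j) * ((n₁ : ℂ) - j - 1) * e j) := by
      rcases Nat.lt_or_ge (n₁ - j) 2 with h2 | h2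
      · have : n₁ - j = 0 ∨ n₁ - j = 1 := by omega
        rw [← hb]
        rcases this with h3 | h3 <;> simp [h3]
      · rw [show n₁ - j - 1 - 1 + 1 = n₁ - j - 1 by omega, Nat.cast_sub (show 1 ≤ n₁ - j by omega), hb]
        simp only [e]
        push_cast
        ring
    have t2 : (j : ℂ) * delta (n₂ - j + 1) (n₁ - j) (j - 1) φ = j * e (j - 1) := by
      rcases Nat.eq_zero_or_pos j with rfl | hj0
      · simp
      · simp only [e]
        rw [show n₂ - (j - 1) = n₂ - j + 1 by omega, show n₁ - (j - 1) - 1 = n₁ - j by omega]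
    rw [t1, hb]
    simp only [c]
    linear_combination kernelCoeff lam n₁ j * t2
  rw [kernelFunctional_apply, Finset.sum_congr rfl hterm, Finset.sum_add_distrib,
    Finset.sum_range_succ' (fun j => c j * (j : ℂ) * e (j - 1)), Finset.sum_range_succ]
  have hs : ∀ j, c (j + 1) * ((j + 1 : ℕ) : ℂ) * e (j + 1 - 1) =
      c j * ((n₁ : ℂ) - j) * (lam 2 - lam 1 - n₁ + j) * e j := by
    intro j
    rw [Nat.add_sub_cancel, Nat.cast_succ]
    simp only [c]
    rw [kernelCoeff_succ]
  simp_rw [hs]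
  -- The boundary term vanishes through `n₁ - m = 0` if `n₁ ≤ n₂`. Otherwise `m = n₂`, and the
  -- factor completes the Pochhammer symbol of length `n₂ + 1`, which contains the zero factor
  -- indexed by `k₀`.
  have hlast : c m * ((n₁ : ℂ) - m) * (lam 2 - lam 1 - n₁ + m) = 0 := by
    rcases le_total n₁ n₂ with hle | hle
    · simp [m, min_eq_left hle]
    · rcases h with h | ⟨k₀, hk, h0⟩
      · simp [m, min_eq_left h]
      · have hm : m = n₂ := min_eq_right hle
        have hp : (ascPochhammer ℂ (n₂ + 1)).eval (lam 2 - lam 1 - (n₁ : ℂ)) = 0 := by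
          exact ascPochhammer_eval_eq_zero h0 (by omega)
        rw [ascPochhammer_succ_eval] at hp
        simp only [c, hm, kernelCoeff]
        linear_combination ((-1) ^ n₂ * (ascPochhammer ℂ n₂).eval (-(n₁ : ℂ)) /
          (n₂.factorial : ℂ) * ((n₁ : ℂ) - n₂)) * hp
  rw [hlast, Finset.sum_neg_distrib]
  simp

end Smooth

section

namespace Smooth

/-! ### Smooth dependence on parameters -/

section Parametric

variable {E : Type} [NormedAddCommGroup E] [NormedSpace ℝ E]

/-- Endomorphisms that act on smooth families of smooth functions, compatibly with the
derivative in the parameter. -/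
def IsParametric (O : Set E) (S : Module.End ℂ Smooth) : Prop :=
  ∀ G : E × ℝ × ℝ × ℝ → ℂ, ContDiffOn ℝ ∞ G (O ×ˢ Set.univ) →
    ∃ G' : E × ℝ × ℝ × ℝ → ℂ, ContDiffOn ℝ ∞ G' (O ×ˢ Set.univ) ∧
      (∀ e ∈ O, ∀ φ : Smooth, (∀ v, φ.1 v = G (e, v)) → ∀ v, (S φ).1 v = G' (e, v)) ∧
      ∀ u, ∀ e ∈ O, ∀ φ : Smooth, (∀ v, φ.1 v = fderiv ℝ G (e, v) (u, 0)) →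
        ∀ v, (S φ).1 v = fderiv ℝ G' (e, v) (u, 0)

theorem IsParametric.one (O : Set E) : IsParametric O 1 :=
  fun G hG => ⟨G, hG, fun _ _ _ h => h, fun _ _ _ _ h => h⟩

theorem IsParametric.mul {O : Set E} {S S' : Module.End ℂ Smooth} (hS : IsParametric O S)
    (hS' : IsParametric O S') : IsParametric O (S * S') := by
  intro G hG
  obtain ⟨G₁, h1, h2, h3⟩ := hS' G hG
  obtain ⟨G₂, h4, h5, h6⟩ := hS G₁ h1
  exact ⟨G₂, h4, fun e he φ hφ => h5 e he _ (h2 e he φ hφ),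
    fun u e he φ hφ => h6 u e he _ (h3 u e he φ hφ)⟩

theorem IsParametric.pow {O : Set E} {S : Module.End ℂ Smooth} (hS : IsParametric O S) (n : ℕ) :
    IsParametric O (S ^ n) := by
  induction n with
  | zero => exact IsParametric.one O
  | succ n ih =>
    rw [pow_succ]
    exact ih.mul hS

/-- Compatibility with the parameter derivative is the symmetry of second derivatives on the
product. -/
theorem isParametric_D {O : Set E} (hO : IsOpen O) (w : ℝ × ℝ × ℝ) : IsParametric O (D w) := by
  intro G hG
  have hU : IsOpen (O ×ˢ (Set.univ : Set (ℝ × ℝ × ℝ))) := hO.prod isOpen_univ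
  have hG1 : ContDiffOn ℝ ∞ (fderiv ℝ G) (O ×ˢ Set.univ) :=
    hG.fderiv_of_isOpen hU (m := ∞) (by simp)
  have hat : ∀ e ∈ O, ∀ v, ContDiffAt ℝ ∞ G (e, v) := fun e he v =>
    hG.contDiffAt (hU.mem_nhds ⟨he, trivial⟩)
  have hd1 : ∀ e ∈ O, ∀ v, DifferentiableAt ℝ (fderiv ℝ G) (e, v) := fun e he v =>
    (hG1.contDiffAt (hU.mem_nhds ⟨he, trivial⟩)).differentiableAt (by simp)
  have hslice : ∀ (e : E) (v : ℝ × ℝ × ℝ),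
      HasFDerivAt (fun v => (e, v)) (ContinuousLinearMap.inr ℝ E (ℝ × ℝ × ℝ)) v := fun e v =>
    hasFDerivAt_prodMk_right e v
  refine ⟨fun p => fderiv ℝ G p (0, w), hG1.clm_apply contDiffOn_const, ?_, ?_⟩
  · intro e he φ hφ v
    have h1 : φ.1 = G ∘ fun v => (e, v) := funext hφ
    have h2 := ((hat e he v).differentiableAt (by simp)).hasFDerivAt.comp v (hslice e v)
    rw [D_apply, h1, h2.fderiv]
    simp
  · intro u e he φ hφ v
    have h1 : φ.1 = fun v => fderiv ℝ G (e, v) (u, 0) := funext hφ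
    have h2 : HasFDerivAt (fun v => fderiv ℝ G (e, v))
        ((fderiv ℝ (fderiv ℝ G) (e, v)).comp (ContinuousLinearMap.inr ℝ E (ℝ × ℝ × ℝ))) v :=
      (hd1 e he v).hasFDerivAt.comp v (hslice e v)
    have h3 := h2.clm_apply (hasFDerivAt_const ((u, 0) : E × ℝ × ℝ × ℝ) v)
    have h4 := (hd1 e he v).hasFDerivAt.clm_apply
      (hasFDerivAt_const ((0, w) : E × ℝ × ℝ × ℝ) (e, v))
    rw [D_apply, h1, h3.fderiv, h4.fderiv]
    have hsymm := ((hat e he v).isSymmSndFDerivAt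
      (by simpa using WithTop.coe_le_coe.2 (le_top : (2 : ℕ∞) ≤ ⊤))).eq (0, w) (u, 0)
    simpa using hsymm

theorem isParametric_partials {O : Set E} (hO : IsOpen O) (a b c : ℕ) :
    IsParametric O (partials a b c) :=
  (((isParametric_D hO _).pow a).mul ((isParametric_D hO _).pow b)).mul
    ((isParametric_D hO _).pow c)

/-- Used twice: it gives smoothness of the image function on `GL (2, ℝ)`, and it allows the kernel
functional to be interchanged with the derivative along a one-parameter group. -/
theorem exists_parametric_kernelFunctional {O : Set E} (hO : IsOpen O) (lam : Fin 3 → ℂ)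
    (n₁ n₂ : ℕ) {G : E × ℝ × ℝ × ℝ → ℂ} (hG : ContDiffOn ℝ ∞ G (O ×ˢ Set.univ)) :
    ∃ F : E → ℂ, ContDiffOn ℝ ∞ F O ∧
      (∀ e ∈ O, ∀ φ : Smooth, (∀ v, φ.1 v = G (e, v)) → kernelFunctional lam n₁ n₂ φ = F e) ∧
      ∀ u, ∀ e ∈ O, ∀ φ : Smooth, (∀ v, φ.1 v = fderiv ℝ G (e, v) (u, 0)) →
        kernelFunctional lam n₁ n₂ φ = fderiv ℝ F e u := by
  choose P hP1 hP2 hP3 using fun j : ℕ =>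
    isParametric_partials hO (n₂ - j) (n₁ - j) j G hG
  let κ : ℕ → ℂ := fun j => kernelCoeff lam n₁ j * (-1) ^ (n₂ - j + (n₁ - j) + j)
  have hP0 : ∀ j, ContDiffOn ℝ ∞ (fun e => κ j * P j (e, 0)) O := fun j =>
    contDiffOn_const.mul ((hP1 j).comp (contDiff_id.prodMk contDiff_const).contDiffOn
      fun e he => ⟨he, trivial⟩)
  refine ⟨fun e => ∑ j ∈ Finset.range (min n₁ n₂ + 1), κ j * P j (e, 0),
    ContDiffOn.sum fun j _ => hP0 j, ?_, ?_⟩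
  · intro e he φ hφ
    rw [kernelFunctional_apply]
    refine Finset.sum_congr rfl fun j _ => ?_
    rw [delta_apply, hP2 j e he φ hφ, mul_assoc]
  · intro u e he φ hφ
    have hd : ∀ j, HasFDerivAt (fun e => κ j * P j (e, 0))
        (κ j • (fderiv ℝ (P j) (e, 0)).comp (ContinuousLinearMap.inl ℝ E (ℝ × ℝ × ℝ))) e := by
      intro j
      have h1 : HasFDerivAt (P j) (fderiv ℝ (P j) (e, 0)) (e, 0) :=
        (((hP1 j).contDiffAt ((hO.prod isOpen_univ).mem_nhds ⟨he, trivial⟩)).differentiableAt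
          (by simp)).hasFDerivAt
      exact (h1.comp e (hasFDerivAt_prodMk_left e 0)).const_mul (κ j)
    rw [(HasFDerivAt.fun_sum fun j _ => hd j).fderiv, kernelFunctional_apply,
      sum_apply]
    refine Finset.sum_congr rfl fun j _ => ?_
    rw [delta_apply, hP3 j u e he φ hφ]
    simp [κ, mul_assoc]

end Parametric

end Smooth

/-! ### Smoothness and unipotent invariance of the kernel pairing -/

variable {ξ : Fin 3 → ZMod 2} {lam : Fin 3 → ℂ} {η : Fin 2 → ZMod 2} {ν : Fin 2 → ℂ}
  {n₁ n₂ : ℕ}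

theorem kernelOperator_eq (f : principalSeries 3 ξ lam) (h : GLn 2) :
    kernelOperator lam n₁ n₂ f h = Smooth.kernelFunctional lam n₁ n₂ (restrict ξ lam h f) := by
  rw [kernelOperator, Smooth.kernelFunctional_apply]
  refine Finset.sum_congr rfl fun j _ => ?_
  rw [← Smooth.deltaPairing_eq]
  rfl

theorem restrict_eq_extendZero (f : principalSeries 3 ξ lam) (h : GLn 2) (v : ℝ × ℝ × ℝ) :
    (restrict ξ lam h f).1 v =
      extendZero f (cell (fun i j => (h : Matrix (Fin 2) (Fin 2) ℝ) i j) v) := by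
  rw [restrict_apply, ← extendZero_coe (f : GLn 3 → ℂ), coe_embed_mul]

theorem isSmooth_kernelFunctional (f : principalSeries 3 ξ lam) :
    IsSmooth fun h => Smooth.kernelFunctional lam n₁ n₂ (restrict ξ lam h f) := by
  obtain ⟨F, hF, hF', -⟩ := Smooth.exists_parametric_kernelFunctional (isOpen_det_ne_zero 2) lam
    n₁ n₂ (contDiffOn_extendZero_cell f.2.1)
  have h1 : (fun h => Smooth.kernelFunctional lam n₁ n₂ (restrict ξ lam h f)) =
      fun h : GLn 2 => F fun i j => (h : Matrix (Fin 2) (Fin 2) ℝ) i j := by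
    funext h
    exact hF' _ h.det_ne_zero _ (restrict_eq_extendZero f h)
  rw [h1]
  exact isSmooth_of_contDiffAt F fun A hA =>
    hF.contDiffAt ((isOpen_det_ne_zero 2).mem_nhds hA)

/-- The derivative of `s ↦ f (h n_s x₀ n̄(v))` at `s = 0`. -/
theorem hasDerivAt_restrict_unipotentTwo (f : principalSeries 3 ξ lam) (h : GLn 2)
    (v : ℝ × ℝ × ℝ) :
    HasDerivAt (fun r => (restrict ξ lam (h * unipotentTwo r) f).1 v)
      (((lam 2 - lam 1 - 1) • (Smooth.Y * restrict ξ lam h f) +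
        Smooth.Z * Smooth.D (1, 0, 0) (restrict ξ lam h f) -
        Smooth.Y * (Smooth.Y * Smooth.D (0, 1, 0) (restrict ξ lam h f))).1 v) 0 := by
  set φ := restrict ξ lam h f
  have hlin : HasDerivAt (fun r : ℝ => 1 + r * v.2.1) v.2.1 0 := by
    simpa using ((hasDerivAt_id (0 : ℝ)).mul_const v.2.1).const_add 1
  have hexp : HasDerivAt (fun r : ℝ =>
      Complex.exp ((lam 2 - lam 1 - 1) * (Real.log (1 + r * v.2.1) : ℂ)))
      ((lam 2 - lam 1 - 1) * v.2.1) 0 := by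
    have h1 : HasDerivAt (fun r : ℝ => Real.log (1 + r * v.2.1)) v.2.1 0 := by
      simpa using hlin.log (by simp)
    simpa using ((h1.ofReal_comp).const_mul (lam 2 - lam 1 - 1)).cexp
  have hpath : HasDerivAt
      (fun r : ℝ => (v.1 + r * v.2.2, v.2.1 / (1 + r * v.2.1), v.2.2))
      (v.2.2, -(v.2.1 * v.2.1), 0) 0 := by
    refine HasDerivAt.prodMk ?_ (HasDerivAt.prodMk ?_ (hasDerivAt_const _ _))
    · simpa using ((hasDerivAt_id (0 : ℝ)).mul_const v.2.2).const_add v.1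
    · have := (hasDerivAt_const (0 : ℝ) v.2.1).fun_div hlin (by simp)
      simpa using this
  have hφ : HasDerivAt
      (fun r : ℝ => φ.1 (v.1 + r * v.2.2, v.2.1 / (1 + r * v.2.1), v.2.2))
      (fderiv ℝ φ.1 v (v.2.2, -(v.2.1 * v.2.1), 0)) 0 := by
    have h1 : HasFDerivAt φ.1 (fderiv ℝ φ.1 v)
        (v.1 + 0 * v.2.2, v.2.1 / (1 + 0 * v.2.1), v.2.2) := by
      have : (v.1 + 0 * v.2.2, v.2.1 / (1 + 0 * v.2.1), v.2.2) = v := by simp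
      rw [this]
      exact (Smooth.differentiable φ v).hasFDerivAt
    exact h1.comp_hasDerivAt (0 : ℝ) hpath
  have hmul := hexp.mul hφ
  have hev : (fun r => (restrict ξ lam (h * unipotentTwo r) f).1 v) =ᶠ[𝓝 0]
      fun r : ℝ => Complex.exp ((lam 2 - lam 1 - 1) * (Real.log (1 + r * v.2.1) : ℂ)) *
        φ.1 (v.1 + r * v.2.2, v.2.1 / (1 + r * v.2.1), v.2.2) := by
    have hpos : ∀ᶠ r : ℝ in 𝓝 0, 0 < 1 + r * v.2.1 :=
      ContinuousAt.eventually_lt (by fun_prop) (by fun_prop) (by simp)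
    filter_upwards [hpos] with r hr using restrict_mul_unipotentTwo f h r hr
  refine (hmul.congr_of_eventuallyEq hev).congr_deriv ?_
  have hv : ((v.2.2, -(v.2.1 * v.2.1), 0) : ℝ × ℝ × ℝ) =
      v.2.2 • (1, 0, 0) + (-(v.2.1 * v.2.1)) • (0, 1, 0) := by
    ext <;> simp
  rw [hv, map_add, map_smul, map_smul]
  change _ = (lam 2 - lam 1 - 1) * ((v.2.1 : ℂ) * φ.1 v) +
    (v.2.2 : ℂ) * fderiv ℝ φ.1 v (1, 0, 0) -
    (v.2.1 : ℂ) * ((v.2.1 : ℂ) * fderiv ℝ φ.1 v (0, 1, 0))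
  simp
  ring

/-- Along `r ↦ h n_r` the pairing has derivative zero by infinitesimal invariance, so it is
constant. The condition `hc` is what makes the boundary term of the telescoping sum vanish. -/
theorem kernelFunctional_restrict_unipotentTwo
    (hc : n₁ ≤ n₂ ∨ ∃ k₀ : ℕ, k₀ ≤ n₂ ∧ lam 2 - lam 1 - (n₁ : ℂ) + (k₀ : ℂ) = 0)
    (f : principalSeries 3 ξ lam) (h : GLn 2) (s : ℝ) :
    Smooth.kernelFunctional lam n₁ n₂ (restrict ξ lam (h * unipotentTwo s) f) =
      Smooth.kernelFunctional lam n₁ n₂ (restrict ξ lam h f) := by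
  have hO := isOpen_det_ne_zero 2
  have hG := contDiffOn_extendZero_cell f.2.1
  have hres := restrict_eq_extendZero f
  generalize hGdef : (fun p : (Fin 2 → Fin 2 → ℝ) × ℝ × ℝ × ℝ =>
    extendZero (f : GLn 3 → ℂ) (cell p.1 p.2)) = G at hG
  replace hres : ∀ (k : GLn 2) v, (restrict ξ lam k f).1 v =
      G (fun i j => (k : Matrix (Fin 2) (Fin 2) ℝ) i j, v) := fun k v => by
    rw [hres, ← hGdef]
  clear hGdef
  obtain ⟨F, hF, hF', hF''⟩ := Smooth.exists_parametric_kernelFunctional hO lam n₁ n₂ hG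
  let A : ℝ → Fin 2 → Fin 2 → ℝ := fun r i j =>
    ((h * unipotentTwo r : GLn 2) : Matrix (Fin 2) (Fin 2) ℝ) i j
  let w : Fin 2 → Fin 2 → ℝ := fun i j => if j = 1 then (h : Matrix (Fin 2) (Fin 2) ℝ) i 0 else 0
  have hAO : ∀ r, A r ∈ {B : Fin 2 → Fin 2 → ℝ | (Matrix.of B).det ≠ 0} :=
    fun r => (h * unipotentTwo r).det_ne_zero
  have hA : ∀ r, HasDerivAt A w r := by
    intro r
    have e : A = fun r => (fun i j => (h : Matrix (Fin 2) (Fin 2) ℝ) i j) + r • w := by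
      funext r i j
      fin_cases j <;>
        simp [A, w, unipotentTwo, Matrix.GeneralLinearGroup.mkOfDetNeZero, Matrix.mul_apply,
          Fin.sum_univ_succ]
      ring
    rw [e]
    simpa using ((hasDerivAt_id r).smul_const w).const_add
      (fun i j => (h : Matrix (Fin 2) (Fin 2) ℝ) i j)
  have hu : ∀ r, HasDerivAt (fun r => F (A r)) 0 r := by
    intro r
    have h1 : HasFDerivAt F (fderiv ℝ F (A r)) (A r) :=
      ((hF.contDiffAt (hO.mem_nhds (hAO r))).differentiableAt (by simp)).hasFDerivAt
    have h2 := h1.comp_hasDerivAt r (hA r)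
    refine h2.congr_deriv ?_
    -- With base point `h n_r`, the derivative at time `r` becomes one at time `0`. The two
    -- expressions for it, through the family `G` and through the explicit vector field, agree by
    -- uniqueness of derivatives.
    rw [← hF'' w (A r) (hAO r) _ ?_, Smooth.kernelFunctional_invariant hc
      (restrict ξ lam (h * unipotentTwo r) f)]
    intro v
    refine (hasDerivAt_restrict_unipotentTwo f (h * unipotentTwo r) v).unique ?_
    have h3 : HasFDerivAt G (fderiv ℝ G (A r, v)) (A (r + 0), v) := by
      rw [add_zero]
      have hmem : (A r, v) ∈ {B : Fin 2 → Fin 2 → ℝ | (Matrix.of B).det ≠ 0} ×ˢ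
        (Set.univ : Set (ℝ × ℝ × ℝ)) := ⟨hAO r, trivial⟩
      exact ((hG.contDiffAt ((hO.prod isOpen_univ).mem_nhds hmem)).differentiableAt
        (by simp)).hasFDerivAt
    have h4 : HasDerivAt (fun t : ℝ => (A (r + t), v)) (w, 0) 0 :=
      ((hA (r + 0)).comp_const_add r 0).prodMk (hasDerivAt_const _ _)
    have h5 := h3.comp_hasDerivAt (0 : ℝ) h4
    refine h5.congr_of_eventuallyEq (Filter.Eventually.of_forall fun t => ?_)
    change (restrict ξ lam (h * unipotentTwo r * unipotentTwo t) f).1 v = _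
    rw [hres, mul_assoc, ← unipotentTwo_add]
    rfl
  have hconst := is_const_of_deriv_eq_zero (fun r => (hu r).differentiableAt)
    (fun r => (hu r).deriv) s 0
  have hval : ∀ r, F (A r) =
      Smooth.kernelFunctional lam n₁ n₂ (restrict ξ lam (h * unipotentTwo r) f) := fun r =>
    (hF' (A r) (hAO r) _ (hres (h * unipotentTwo r))).symm
  rw [← hval, hconst, hval, unipotentTwo_zero, mul_one]

end

section

variable {ξ : Fin 3 → ZMod 2} {lam : Fin 3 → ℂ} {η : Fin 2 → ZMod 2} {ν : Fin 2 → ℂ}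
  {n₁ n₂ : ℕ}

/-! ### The kernel operator -/

theorem signedPow_mul_pow (ξ : ZMod 2) (s : ℂ) {x : ℝ} (hx : x ≠ 0) (n : ℕ) :
    signedPow ξ s x * (x : ℂ) ^ n = signedPow (ξ + n) (s + n) x := by
  have hsign : (-1 : ℂ) ^ (ξ + n).val = (-1) ^ ξ.val * (-1) ^ n := by
    rw [← pow_add, neg_one_pow_eq_pow_mod_two, neg_one_pow_eq_pow_mod_two (ξ.val + n),
      ZMod.val_add, ZMod.val_natCast]
    simp
  rcases hx.lt_or_gt with h | h
  · obtain ⟨y, rfl⟩ : ∃ y, x = -y := ⟨-x, by simp⟩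
    have hy : 0 < y := neg_neg_iff_pos.1 (by simpa using h)
    have hy' : (y : ℂ) ≠ 0 := by exact_mod_cast hy.ne'
    rw [signedPow_neg _ _ hy, signedPow_neg _ _ hy, Complex.cpow_add _ _ hy',
      Complex.cpow_natCast, hsign, Complex.ofReal_neg, neg_pow (y : ℂ)]
    ring
  · have hx' : (x : ℂ) ≠ 0 := by exact_mod_cast h.ne'
    rw [signedPow_of_pos _ _ h, signedPow_of_pos _ _ h, Complex.cpow_add _ _ hx',
      Complex.cpow_natCast]

theorem kernelFunctional_restrict_diagTwo (hc : DSBO0Condition ξ lam η ν n₁ n₂)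
    (f : principalSeries 3 ξ lam) (h : GLn 2) (a b : ℝ) (ha : a ≠ 0) (hb : b ≠ 0) :
    Smooth.kernelFunctional lam n₁ n₂ (restrict ξ lam (h * diagTwo a b ha hb) f) =
      inducingFactor 2 η ν (diagTwo a b ha hb) *
        Smooth.kernelFunctional lam n₁ n₂ (restrict ξ lam h f) := by
  obtain ⟨h1, h2, -, h3, h4⟩ := hc
  have ha' : (a : ℂ) ^ n₁ ≠ 0 := pow_ne_zero _ (by exact_mod_cast ha)
  have e1 : signedPow (ξ 1) (-lam 1) a * (a : ℂ) ^ n₂ =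
      signedPow (η 0) (-ν 0 - 1 / 2) a * (a : ℂ) ^ n₁ := by
    rw [signedPow_mul_pow _ _ ha, signedPow_mul_pow _ _ ha]
    congr 1
    -- The parities `n₂` and `n₁ + n₂ + n₁` differ by `2 n₁`.
    · have : (2 : ZMod 2) = 0 := rfl
      rw [h3]
      push_cast
      linear_combination (-(n₁ : ZMod 2)) * this
    · linear_combination h1 - h2
  have e2 : signedPow (ξ 2) (1 - lam 2) b * (b : ℂ) ^ n₁ = signedPow (η 1) (1 / 2 - ν 1) b := by
    rw [signedPow_mul_pow _ _ hb, ← h4]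
    congr 1
    linear_combination -h1
  rw [restrict_mul_diagTwo, map_smul, smul_eq_mul, inducingFactor_diagTwo]
  refine mul_left_cancel₀ ha' ?_
  have e3 := Smooth.kernelFunctional_dil lam n₁ n₂ (b := b) ha (restrict ξ lam h f)
  rw [mul_left_comm, e3, ← e2]
  linear_combination (signedPow (ξ 2) (1 - lam 2) b * (b : ℂ) ^ n₁ *
    Smooth.kernelFunctional lam n₁ n₂ (restrict ξ lam h f)) * e1

theorem kernelFunctional_restrict_mul (hc : DSBO0Condition ξ lam η ν n₁ n₂)
    (f : principalSeries 3 ξ lam) (h : GLn 2) {p : GLn 2} (hp : p ∈ borel 2) :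
    Smooth.kernelFunctional lam n₁ n₂ (restrict ξ lam (h * p) f) =
      inducingFactor 2 η ν p * Smooth.kernelFunctional lam n₁ n₂ (restrict ξ lam h f) := by
  obtain ⟨a, b, s, ha, hb, rfl⟩ := exists_eq_diagTwo_mul hp
  rw [← mul_assoc, kernelFunctional_restrict_unipotentTwo hc.2.2.1,
    kernelFunctional_restrict_diagTwo hc, inducingFactor_mul (diagTwo_mem a b ha hb)
    (unipotentTwo_mem s), inducingFactor_unipotentTwo, mul_one]

/-- The differential symmetry breaking operator attached to the distribution kernel. -/
def kernelMap (hc : DSBO0Condition ξ lam η ν n₁ n₂) :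
    principalSeries 3 ξ lam →ₗ[ℂ] principalSeries 2 η ν where
  toFun f := ⟨fun h => Smooth.kernelFunctional lam n₁ n₂ (restrict ξ lam h f),
    isSmooth_kernelFunctional f, fun h _ hp => kernelFunctional_restrict_mul hc f h hp⟩
  map_add' f g := by
    ext h
    simp
  map_smul' c f := by
    ext h
    simp

theorem kernelMap_apply (hc : DSBO0Condition ξ lam η ν n₁ n₂) (f : principalSeries 3 ξ lam)
    (h : GLn 2) : (kernelMap hc f : GLn 2 → ℂ) h =
      Smooth.kernelFunctional lam n₁ n₂ (restrict ξ lam h f) := rfl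

theorem continuous_embed : Continuous embed := by
  refine Continuous.units_map blockHom ?_
  refine continuous_matrix fun i j => ?_
  fin_cases i <;> fin_cases j <;> simp [blockHom] <;> fun_prop

theorem continuous_p0 : Continuous p0 := by
  refine Continuous.quotient_lift ?_ _
  exact QuotientGroup.continuous_mk.comp (continuous_embed.mul continuous_const)

theorem nbar_inv (x y z : ℝ) : (nbar x y z)⁻¹ = nbar (-x) (-y) (x * y - z) := by
  refine inv_eq_of_mul_eq_one_right ?_
  ext i j
  fin_cases i <;> fin_cases j <;>
    simp [nbar, Matrix.GeneralLinearGroup.mkOfDetNeZero, Matrix.mul_apply, Fin.sum_univ_succ]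
  ring

theorem continuous_nbar :
    Continuous fun v : ℝ × ℝ × ℝ => nbar v.1 v.2.1 v.2.2 := by
  have h : ∀ x y z : ℝ × ℝ × ℝ → ℝ, Continuous x → Continuous y → Continuous z →
      Continuous fun v => (nbar (x v) (y v) (z v) : Matrix (Fin 3) (Fin 3) ℝ) := by
    intro x y z hx hy hz
    refine continuous_matrix fun i j => ?_
    fin_cases i <;> fin_cases j <;>
      simp [nbar, Matrix.GeneralLinearGroup.mkOfDetNeZero] <;> fun_prop
  rw [Units.continuous_iff]
  refine ⟨h _ _ _ (by fun_prop) (by fun_prop) (by fun_prop), ?_⟩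
  simp_rw [nbar_inv]
  exact h _ _ _ (by fun_prop) (by fun_prop) (by fun_prop)

/-- Equivariance holds because left translation only moves the base point `h`. For the support
condition, vanishing of `f` near `h x₀` makes the germ at the origin zero, and the kernel functional
is local. -/
theorem kernelMap_mem (hc : DSBO0Condition ξ lam η ν n₁ n₂) :
    kernelMap hc ∈ DSBO0 ξ lam η ν := by
  refine ⟨fun h f => ?_, fun f => ?_⟩
  · ext k
    change Smooth.kernelFunctional lam n₁ n₂ (restrict ξ lam k _) =
      Smooth.kernelFunctional lam n₁ n₂ (restrict ξ lam (h⁻¹ * k) f)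
    rw [restrict_rep]
  · rw [sectionSupport]
    refine (image_closure_subset_closure_image continuous_p0).trans
      (closure_minimal ?_ isClosed_closure)
    rintro _ ⟨_, ⟨h, hh, rfl⟩, rfl⟩
    change ((embed h * x0 : GLn 3) : GLn 3 ⧸ borel 3) ∈ sectionSupport (f : GLn 3 → ℂ)
    rw [mem_sectionSupport_iff]
    intro hev
    apply hh
    have hcont : Filter.Tendsto (fun v : ℝ × ℝ × ℝ => embed h * x0 * nbar v.1 v.2.1 v.2.2)
        (𝓝 0) (𝓝 (embed h * x0)) := by
      have h0 : Continuous fun v : ℝ × ℝ × ℝ => embed h * x0 * nbar v.1 v.2.1 v.2.2 :=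
        continuous_const.mul continuous_nbar
      have h1 := h0.tendsto 0
      rwa [show nbar (0 : ℝ × ℝ × ℝ).1 (0 : ℝ × ℝ × ℝ).2.1 (0 : ℝ × ℝ × ℝ).2.2 = 1 from nbar_zero,
        mul_one] at h1
    have h2 := Smooth.isLocal_kernelFunctional lam n₁ n₂ (restrict ξ lam h f) 0
      (hcont.eventually hev)
    rw [kernelMap_apply, h2, map_zero]

/-! ### Classification -/

theorem eq_zero_of_germFunctional {T : principalSeries 3 ξ lam →ₗ[ℂ] principalSeries 2 η ν}
    (hT : T ∈ DSBO0 ξ lam η ν) (h : germFunctional T = 0) : T = 0 := by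
  ext f k
  rw [map_apply_eq hT, h]
  rfl

theorem germFunctional_kernelMap (hc : DSBO0Condition ξ lam η ν n₁ n₂) (φ : Smooth) :
    germFunctional (kernelMap hc) φ = Smooth.kernelFunctional lam n₁ n₂ φ := by
  rw [germFunctional_apply, kernelMap_apply, restrict_ofGerm]
  exact Smooth.isLocal_kernelFunctional lam n₁ n₂ _ _ (Smooth.cut_mul_eventuallyEq φ)

theorem kernelMap_ne_zero (hc : DSBO0Condition ξ lam η ν n₁ n₂) : kernelMap hc ≠ 0 := by
  intro h
  apply Smooth.kernelFunctional_leading_ne_zero lam n₁ n₂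
  rw [← germFunctional_kernelMap hc, h]
  rfl

theorem rank_eq_one_of_eq_span {V : Type*} [AddCommMonoid V] [Module ℂ V] {S : Submodule ℂ V}
    {x : V} (hx : x ≠ 0) (hS : S = Submodule.span ℂ {x}) : Module.rank ℂ S = 1 := by
  let _ : AddCommGroup V := Module.addCommMonoidToAddCommGroup ℂ
  exact (rank_submodule_eq_one_iff S).2
    ⟨x, hS ▸ Submodule.mem_span_singleton_self x, hx, hS.le⟩

/-- Subtract the multiple of the kernel operator that cancels the value on `X^n₂ Y^n₁`; the
difference vanishes because this leading value determines an equivariant functional. -/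
theorem DSBO0_eq_span (hc : DSBO0Condition ξ lam η ν n₁ n₂) :
    DSBO0 ξ lam η ν = Submodule.span ℂ {kernelMap hc} := by
  refine le_antisymm (fun T hT => ?_) ?_
  · rw [Submodule.mem_span_singleton]
    let M : Smooth := Smooth.X ^ n₂ * Smooth.Y ^ n₁
    have hM : germFunctional (kernelMap hc) M ≠ 0 := by
      rw [germFunctional_kernelMap]
      exact Smooth.kernelFunctional_leading_ne_zero lam n₁ n₂
    let c := germFunctional T M / germFunctional (kernelMap hc) M
    have hS : T + (-c) • kernelMap hc ∈ DSBO0 ξ lam η ν :=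
      Submodule.add_mem _ hT (Submodule.smul_mem _ (-c) (kernelMap_mem hc))
    have hlead : germFunctional (T + (-c) • kernelMap hc) M = 0 := by
      change germFunctional T M + -c * germFunctional (kernelMap hc) M = 0
      rw [neg_mul, div_mul_cancel₀ _ hM, add_neg_cancel]
    have h0 := eq_zero_of_germFunctional hS
      ((isEquivariant_germFunctional hS).eq_zero_of_leading hc.1 hc.2.1 hlead)
    refine ⟨c, ?_⟩
    ext f k
    have h1 : (T f : GLn 2 → ℂ) k + -c * (kernelMap hc f : GLn 2 → ℂ) k = 0 :=
      congrArg (fun S : principalSeries 3 ξ lam →ₗ[ℂ] principalSeries 2 η ν =>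
        (S f : GLn 2 → ℂ) k) h0
    change c * (kernelMap hc f : GLn 2 → ℂ) k = (T f : GLn 2 → ℂ) k
    linear_combination -h1
  · rw [Submodule.span_singleton_le_iff_mem]
    exact kernelMap_mem hc

end

end SymBreak

end

theorem proposition5p7 (ξ : Fin 3 → ZMod 2) (lam : Fin 3 → ℂ)
    (η : Fin 2 → ZMod 2) (ν : Fin 2 → ℂ) :
    (∀ n₁ n₂ : ℕ, SymBreak.DSBO0Condition ξ lam η ν n₁ n₂ →
      Module.rank ℂ (SymBreak.DSBO0 ξ lam η ν) = 1 ∧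
      ∃ A : SymBreak.principalSeries 3 ξ lam →ₗ[ℂ] SymBreak.principalSeries 2 η ν,
        (∀ (f : SymBreak.principalSeries 3 ξ lam) (h : SymBreak.GLn 2),
          (A f : SymBreak.GLn 2 → ℂ) h = SymBreak.kernelOperator lam n₁ n₂ f h) ∧
        A ≠ 0 ∧ SymBreak.DSBO0 ξ lam η ν = Submodule.span ℂ {A}) ∧
    ((¬ ∃ n₁ n₂ : ℕ, SymBreak.DSBO0Condition ξ lam η ν n₁ n₂) →
      Module.rank ℂ (SymBreak.DSBO0 ξ lam η ν) = 0) := by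
  refine ⟨fun n₁ n₂ hc => ⟨?_, SymBreak.kernelMap hc, fun f h => ?_,
    SymBreak.kernelMap_ne_zero hc, SymBreak.DSBO0_eq_span hc⟩, fun hc => ?_⟩
  · exact SymBreak.rank_eq_one_of_eq_span (SymBreak.kernelMap_ne_zero hc)
      (SymBreak.DSBO0_eq_span hc)
  · rw [SymBreak.kernelOperator_eq, SymBreak.kernelMap_apply]
  · have hbot : SymBreak.DSBO0 ξ lam η ν = ⊥ := by
      rw [Submodule.eq_bot_iff]
      intro T hT
      by_contra hne
      exact hc ((SymBreak.isEquivariant_germFunctional hT).exists_condition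
        fun h => hne (SymBreak.eq_zero_of_germFunctional hT h))
    rw [hbot, rank_bot]
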